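/- **Definitions.** An SM instance has a finite set $M$ of men and a finite set $W$ of women; each agent strictly ranks, in a preference list, a subset of the agents of the other side. Lists are consistent ($w$ is on the list of $m$ if and only if $m$ is on the list of $w$), and all agents are matched in every stable matching, so $|M|=|W|$. For $k\ge 1$, the instance is $k$-bounded if it has $n\geq 1$ men and $n$ women and all its preference lists have length at most $k$. A rotation exposed in a stable matching $\mu$ is a nonempty circular list without repetitions $(m_1,w_1),\dots,(m_\ell,w_\ell)$ of pairs of $\mu$ such that $w_{i+1}$ is the first woman after $w_i$ on the list of $m_i$ who prefers $m_i$ to her partner in $\mu$ (indices modulo $\ell$). Eliminating it replaces the pairs $(m_i,w_i)$ of $\mu$ by $(m_i,w_{i+1})$. The rotation poset of an instance consists of all rotations exposed in some stable matching, with $\rho\prec\rho'$ if, for every stable matching $\mu$ in which $\rho'$ is exposed, $\rho$ is among the rotations that are eliminated on the way from the man-optimal stable matching to $\mu$. An instance realizes a poset $\mathcal P$ if its rotation poset is isomorphic to $\mathcal P$. Let $H=(V,E)$ be the Hasse diagram of $\mathcal P$ and $\phi:E\to\{1,2,\dots\}$ an edge colouring. It is a super colouring if any two different edges entering the same vertex,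 and any two different edges leaving the same vertex, have different colours. $\mathsf{ConstructInstance}(H,\phi)$ is the following instance. Let $C_v$ be the set of colours of the edges incident to $v$, to which the colours $1$ and/or $2$ are added so that $|C_v|=2$ if there are fewer than two; fix a cyclic ordering of each $C_v$, and let $c^+$ be the colour after $c$. There are a man $m_{c,v}$ and a woman $w_{c,v}$ for all $v\in V$ and $c\in C_v$. The list of $m_{c,v}$ consists of $w_{c,v}$, then the women $w_{c,u}$ for the edges $(u,v)$ of colour $c$ (in the order in which the edges are processed), then $w_{c^+,v}$. The list of $w_{c,v}$ consists of $m_{d,v}$ with $d^+=c$, then the men $m_{c,x}$ for the edges $(v,x)$ of colour $c$ (in the reverse order), then $m_{c,v}$. **Theorem.** Every finite poset $\mathcal P$ is realized by a $3$-bounded SM instance $I(\mathcal P)$. Moreover, there is an algorithm (for a unit-cost random access machine with addition and subtraction) that, given the Hasse diagram of $\mathcal P$ with $p$ vertices and $q$ edges, as a list of its edges in any order and with any numbering of the vertices, constructs such an $I(\mathcal P)$ in $O(p+q+1)$ time, and $I(\mathcal P)$ has $O(p+q+1)$ agents, with absolute constants. If $\mathcal P$ is nonempty, $I(\mathcal P)$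 is, up to the names of the agents, $\mathsf{ConstructInstance}(H,\phi)$ for some super colouring $\phi$ of the Hasse diagram $H$ of $\mathcal P$. Hence, for every $k\ge 3$, every finite poset is realized by a $k$-bounded SM instance, constructed by the same algorithm. -/

import Mathlib

/-! Stable matching instances, rotations, the rotation poset, the instance built from an edge
coloured Hasse diagram, and a unit-cost random access machine. -/

namespace StableMarriage

/-! ## Stable matching instances -/

/-- The preference lists of a set `M` of men and a set `W` of women; most preferred first. -/
structure Prefs (M W : Type*) where
  men : M → List W
  women : W → List M

/-- `a` is ranked strictly better than `b` in the list `l`. -/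
def Better {α : Type*} (l : List α) (a b : α) : Prop :=
  ∃ i j : ℕ, i < j ∧ l[i]? = some a ∧ l[j]? = some b

namespace Prefs

variable {M W : Type*}

/-- `m` and `w` are acceptable to each other. -/
def Acceptable (I : Prefs M W) (m : M) (w : W) : Prop :=
  w ∈ I.men m ∧ m ∈ I.women w

/-- A set of acceptable pairs in which every agent occurs at most once. -/
structure IsMatching (I : Prefs M W) (μ : Set (M × W)) : Prop where
  acceptable : ∀ m w, (m, w) ∈ μ → I.Acceptable m w
  man_unique : ∀ m w w', (m, w) ∈ μ → (m, w') ∈ μ → w = w'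
  woman_unique : ∀ m m' w, (m, w) ∈ μ → (m', w) ∈ μ → m = m'

/-- `(m, w)` is acceptable, `m` is unmatched or prefers `w` to his partner, and `w` is unmatched
or prefers `m` to her partner. -/
def IsBlocking (I : Prefs M W) (μ : Set (M × W)) (m : M) (w : W) : Prop :=
  I.Acceptable m w ∧
    ((∀ w', (m, w') ∉ μ) ∨ ∃ w', (m, w') ∈ μ ∧ Better (I.men m) w w') ∧
    ((∀ m', (m', w) ∉ μ) ∨ ∃ m', (m', w) ∈ μ ∧ Better (I.women w) m m')

def IsStable (I : Prefs M W) (μ : Set (M × W)) : Prop :=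
  I.IsMatching μ ∧ ∀ m w, ¬ I.IsBlocking μ m w

/-- The preference lists form an SM instance (with possibly incomplete lists): no list repeats an
agent, the lists are consistent, and all agents appear in every stable matching. -/
structure IsSMInstance (I : Prefs M W) : Prop where
  men_nodup : ∀ m, (I.men m).Nodup
  women_nodup : ∀ w, (I.women w).Nodup
  consistent : ∀ m w, w ∈ I.men m ↔ m ∈ I.women w
  men_matched : ∀ μ, I.IsStable μ → ∀ m, ∃ w, (m, w) ∈ μ
  women_matched : ∀ μ, I.IsStable μ → ∀ w, ∃ m, (m, w) ∈ μ

/-- The stable matching in which every man has his best stable partner. -/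
def IsManOptimal (I : Prefs M W) (μ : Set (M × W)) : Prop :=
  I.IsStable μ ∧ ∀ μ', I.IsStable μ' → ∀ m w w', (m, w) ∈ μ → (m, w') ∈ μ' →
    w = w' ∨ Better (I.men m) w w'

/-! ## Rotations and the rotation poset -/

/-- `w` prefers `m` to her partner in `μ`. -/
def PrefersToPartner (I : Prefs M W) (μ : Set (M × W)) (w : W) (m : M) : Prop :=
  ∃ m', (m', w) ∈ μ ∧ Better (I.women w) m m'

/-- `w'` is the first woman after `w` in the list of `m` who prefers `m` to her partner. -/
def IsNextWoman (I : Prefs M W) (μ : Set (M × W)) (m : M) (w w' : W) : Prop :=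
  Better (I.men m) w w' ∧ I.PrefersToPartner μ w' m ∧
    ∀ w'', Better (I.men m) w w'' → Better (I.men m) w'' w' → ¬ I.PrefersToPartner μ w'' m

section Rotations

variable [DecidableEq M] [DecidableEq W]

/-- `y` is the successor of `x` in the circular list `ρ` without repetitions. -/
def Follows (ρ : Cycle (M × W)) (x y : M × W) : Prop :=
  ∃ (h : ρ.Nodup) (hx : x ∈ ρ), ρ.next h x hx = y

/-- The circular list `ρ` is a rotation exposed in the stable matching `μ`. -/
structure IsExposed (I : Prefs M W) (μ : Set (M × W)) (ρ : Cycle (M × W)) : Prop where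
  stable : I.IsStable μ
  ne_nil : ρ ≠ Cycle.nil
  nodup : ρ.Nodup
  subset : ∀ x, x ∈ ρ → x ∈ μ
  next : ∀ x y, Follows ρ x y → I.IsNextWoman μ x.1 x.2 y.2

/-- The elimination of `ρ` from `μ`: the man of each pair of `ρ` moves to the woman of the next
pair. -/
def eliminate (μ : Set (M × W)) (ρ : Cycle (M × W)) : Set (M × W) :=
  (μ \ {x | x ∈ ρ}) ∪ {z | ∃ x y, Follows ρ x y ∧ z = (x.1, y.2)}

/-- `I.EliminatedTo S μ`: starting from the man-optimal stable matching and eliminating exposed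
rotations one after the other, one reaches `μ`, the set of eliminated rotations being `S`. -/
inductive EliminatedTo (I : Prefs M W) : Set (Cycle (M × W)) → Set (M × W) → Prop
  | start {μ : Set (M × W)} : I.IsManOptimal μ → EliminatedTo I ∅ μ
  | step {S : Set (Cycle (M × W))} {μ : Set (M × W)} {ρ : Cycle (M × W)} :
      EliminatedTo I S μ → I.IsExposed μ ρ → EliminatedTo I (insert ρ S) (eliminate μ ρ)

/-- The set of rotations eliminated on the way from the man-optimal stable matching to `μ`. -/
def rotationsOf (I : Prefs M W) (μ : Set (M × W)) : Set (Cycle (M × W)) :=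
  {ρ | ∃ S, I.EliminatedTo S μ ∧ ρ ∈ S}

/-- The set of all rotations exposed in some stable matching. -/
def rotations (I : Prefs M W) : Set (Cycle (M × W)) :=
  {ρ | ∃ μ, I.IsExposed μ ρ}

/-- The strict order of the rotation poset: `ρ` has been eliminated in every stable matching in
which `ρ'` is exposed. -/
def Precedes (I : Prefs M W) (ρ ρ' : Cycle (M × W)) : Prop :=
  ∀ μ, I.IsExposed μ ρ' → ρ ∈ I.rotationsOf μ

/-- The rotation poset of `I` is isomorphic to the poset `X`. -/
def Realizes (I : Prefs M W) (X : Type*) [PartialOrder X] : Prop :=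
  ∃ f : X ≃ I.rotations, ∀ x y, x < y ↔ I.Precedes (f x) (f y)

end Rotations

/-- `I` and `J` agree up to a renaming of the agents. -/
def IsIso {M' W' : Type*} (I : Prefs M W) (J : Prefs M' W') : Prop :=
  ∃ (σ : M ≃ M') (τ : W ≃ W'),
    (∀ m, (I.men m).map τ = J.men (σ m)) ∧ ∀ w, (I.women w).map σ = J.women (τ w)

end Prefs

/-- The SM instances with `n` men and `n` women whose preference lists all have length at most
`k`. -/
def Bound (k n : ℕ) : Set (Prefs (Fin n) (Fin n)) :=
  {I | I.IsSMInstance ∧ (∀ m, (I.men m).length ≤ k) ∧ ∀ w, (I.women w).length ≤ k}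

/-! ## The instance constructed from an edge coloured Hasse diagram -/

section Construction

variable {X : Type*} [PartialOrder X]

/-- `E` lists the edges of the Hasse diagram of `X`, each one once. -/
def ListsHasseEdges (E : List (X × X)) : Prop :=
  E.Nodup ∧ ∀ x y, (x, y) ∈ E ↔ x ⋖ y

/-- `φ u v` is the colour of the edge `(u, v)` of the Hasse diagram. In- and out-proper: two
different edges that enter the same vertex, or leave the same vertex, have different colours. -/
def IsSuperColoring (φ : X → X → ℕ+) : Prop :=
  (∀ u u' v, u ⋖ v → u' ⋖ v → u ≠ u' → φ u v ≠ φ u' v) ∧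
    ∀ u v v', u ⋖ v → u ⋖ v' → v ≠ v' → φ u v ≠ φ u v'

/-- The colours of the edges of the Hasse diagram that are incident to `v`. -/
def incidentColors (φ : X → X → ℕ+) (v : X) : Set ℕ+ :=
  {c | (∃ u, u ⋖ v ∧ φ u v = c) ∨ ∃ u, v ⋖ u ∧ φ v u = c}

/-- For every vertex `v`, `π v` is an ordering of the set of colours associated with `v`: the
colours of the incident edges, together with the colours `1` and/or `2` if these are needed for
having two colours at `v`. -/
def IsColorOrdering (φ : X → X → ℕ+) (π : X → List ℕ+) : Prop :=
  ∀ v, (π v).Nodup ∧ (π v).length = max 2 (incidentColors φ v).ncard ∧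
    (∀ c ∈ incidentColors φ v, c ∈ π v) ∧
    ∀ c ∈ π v, c ∈ incidentColors φ v ∨ c = 1 ∨ c = 2

/-- The index set of the men `m_{c,v}`, and also of the women `w_{c,v}`: a vertex `v` and a colour
`c` of `v`. -/
abbrev Agent (π : X → List ℕ+) : Type _ := Σ v : X, {c : ℕ+ // c ∈ π v}

/-- The agent of colour `c` at vertex `v`, if there is one. -/
def agent? (π : X → List ℕ+) (v : X) (c : ℕ+) : Option (Agent π) :=
  if h : c ∈ π v then some ⟨v, c, h⟩ else none

/-- The agent at the same vertex with the next colour in the cyclic ordering `π v`. -/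
def nextAgent {π : X → List ℕ+} (a : Agent π) : Agent π :=
  ⟨a.1, (π a.1).next a.2.1 a.2.2, List.next_mem _ _ _⟩

/-- The agent at the same vertex with the previous colour in the cyclic ordering `π v`. -/
def prevAgent {π : X → List ℕ+} (a : Agent π) : Agent π :=
  ⟨a.1, (π a.1).prev a.2.1 a.2.2, List.prev_mem _ _ _⟩

/-- The output of the generic construction, when the edges are processed in the order of the list
`E`. The pair `m_{c,v}`, `w_{c,v}` is put on each other's lists first. Then each edge `(u, v)` of
colour `c` adds `w_{c,u}` at the end of the list of `m_{c,v}` and `m_{c,v}` at the front of the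
list of `w_{c,u}`. Finally, `w_{c⁺,v}` is added at the end of the list of `m_{c,v}` and `m_{c,v}` at
the front of the list of `w_{c⁺,v}`, where `c⁺` is the colour after `c` at `v`. -/
def constructInstance [DecidableEq X] (E : List (X × X)) (φ : X → X → ℕ+) (π : X → List ℕ+) :
    Prefs (Agent π) (Agent π) where
  men a :=
    a :: (E.filterMap (fun e => if e.2 = a.1 ∧ φ e.1 e.2 = a.2.1 then agent? π e.1 a.2.1 else none)
      ++ [nextAgent a])
  women a :=
    prevAgent a ::
      ((E.filterMap
          (fun e => if e.1 = a.1 ∧ φ e.1 e.2 = a.2.1 then agent? π e.2 a.2.1 else none)).reverse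
        ++ [a])

end Construction

/-! ## Running time: structured programs for a unit-cost random access machine

A program uses finitely many integer variables and arrays (both named by natural numbers), a
read-only input tape and a write-only output tape. The only arithmetic operations are addition and
truncated subtraction. Every operation costs one step. -/

namespace RAM

structure State where
  var : ℕ → ℕ
  arr : ℕ → ℕ → ℕ
  input : List ℕ
  output : List ℕ

/-- Expressions; `get a e` is the entry of array `a` at the index `e`. -/
inductive Exp where
  | lit (n : ℕ)
  | var (x : ℕ)
  | get (a : ℕ) (e : Exp)
  | add (e₁ e₂ : Exp)
  | sub (e₁ e₂ : Exp)

def Exp.eval (s : State) : Exp → ℕ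
  | .lit n => n
  | .var x => s.var x
  | .get a e => s.arr a (e.eval s)
  | .add e₁ e₂ => e₁.eval s + e₂.eval s
  | .sub e₁ e₂ => e₁.eval s - e₂.eval s

/-- The number of steps for evaluating an expression. -/
def Exp.cost : Exp → ℕ
  | .lit _ => 1
  | .var _ => 1
  | .get _ e => e.cost + 1
  | .add e₁ e₂ => e₁.cost + e₂.cost + 1
  | .sub e₁ e₂ => e₁.cost + e₂.cost + 1

/-- Programs. The tests are of the form `e₁ < e₂`. `read x` moves the next number of the input to
the variable `x`, `write e` appends a number to the output. -/
inductive Prog where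
  | skip
  | assign (x : ℕ) (e : Exp)
  | store (a : ℕ) (i e : Exp)
  | read (x : ℕ)
  | write (e : Exp)
  | seq (P Q : Prog)
  | ifLt (e₁ e₂ : Exp) (P Q : Prog)
  | whileLt (e₁ e₂ : Exp) (P : Prog)

/-- `Exec P s t s'`: the program `P`, started in state `s`, halts after `t` steps in state `s'`. -/
inductive Exec : Prog → State → ℕ → State → Prop
  | skip (s : State) : Exec .skip s 1 s
  | assign (x : ℕ) (e : Exp) (s : State) :
      Exec (.assign x e) s (e.cost + 1) { s with var := Function.update s.var x (e.eval s) }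
  | store (a : ℕ) (i e : Exp) (s : State) :
      Exec (.store a i e) s (i.cost + e.cost + 1)
        { s with arr := Function.update s.arr a (Function.update (s.arr a) (i.eval s) (e.eval s)) }
  | read (x n : ℕ) (l : List ℕ) (s : State) : s.input = n :: l →
      Exec (.read x) s 1 { s with var := Function.update s.var x n, input := l }
  | write (e : Exp) (s : State) :
      Exec (.write e) s (e.cost + 1) { s with output := s.output ++ [e.eval s] }
  | seq {P Q : Prog} {s s' s'' : State} {t t' : ℕ} :
      Exec P s t s' → Exec Q s' t' s'' → Exec (.seq P Q) s (t + t') s''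
  | ifLt_true {e₁ e₂ : Exp} {P Q : Prog} {s s' : State} {t : ℕ} : e₁.eval s < e₂.eval s →
      Exec P s t s' → Exec (.ifLt e₁ e₂ P Q) s (e₁.cost + e₂.cost + 1 + t) s'
  | ifLt_false {e₁ e₂ : Exp} {P Q : Prog} {s s' : State} {t : ℕ} : ¬ e₁.eval s < e₂.eval s →
      Exec Q s t s' → Exec (.ifLt e₁ e₂ P Q) s (e₁.cost + e₂.cost + 1 + t) s'
  | whileLt_true {e₁ e₂ : Exp} {P : Prog} {s s' s'' : State} {t t' : ℕ} :
      e₁.eval s < e₂.eval s → Exec P s t s' → Exec (.whileLt e₁ e₂ P) s' t' s'' →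
      Exec (.whileLt e₁ e₂ P) s (e₁.cost + e₂.cost + 1 + t + t') s''
  | whileLt_false {e₁ e₂ : Exp} {P : Prog} {s : State} : ¬ e₁.eval s < e₂.eval s →
      Exec (.whileLt e₁ e₂ P) s (e₁.cost + e₂.cost + 1) s

/-- The initial state for a given input: all variables and array entries are `0`. -/
def init (l : List ℕ) : State where
  var _ := 0
  arr _ _ := 0
  input := l
  output := []

/-- On the given input, the program halts after at most `T` steps with the given output. -/
def ComputesWithin (P : Prog) (inp out : List ℕ) (T : ℕ) : Prop :=
  ∃ t s, Exec P (init inp) t s ∧ t ≤ T ∧ s.output = out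

end RAM

/-- The input: the number of vertices, the number of edges, and the list of the edges `(u, v)`, the
vertices being numbered `0, 1, …, p - 1` by `label`. -/
def encodeHasse {X : Type*} {p : ℕ} (label : X ≃ Fin p) (E : List (X × X)) : List ℕ :=
  p :: E.length :: E.flatMap fun e => [(label e.1).val, (label e.2).val]

/-- A preference list as a word: its length followed by its entries. -/
def encodeList {n : ℕ} (l : List (Fin n)) : List ℕ :=
  l.length :: l.map Fin.val

/-- The output: the number of men, then the lists of the men, then the lists of the women. -/
def encodePrefs {n : ℕ} (I : Prefs (Fin n) (Fin n)) : List ℕ :=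
  n :: ((List.ofFn I.men).flatMap encodeList ++ (List.ofFn I.women).flatMap encodeList)

end StableMarriage

open StableMarriage

universe u

/-! Every finite poset is the rotation poset of a stable matching instance with lists of length at
most three, which is computed in linear time. -/

/-! Give every edge of the Hasse diagram a colour of its own, from 3 upwards, and keep 1 and 2 for
padding. This is a super colouring in which every agent belongs to at most one edge, so all lists
have length at most three. There is one man and one woman for each end of an edge, and at most two
more of each per vertex, so the size is linear.

`CyclicClasses` isolates what matters about this instance. The agents at a vertex form a cyclically
ordered class of size at least two. Man `a` ranks woman `a`, then the woman he is linked to below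
(if any), then woman `nxt a`. Woman `a` ranks man `prv a`, then the man linked to her above (if
any), then man `a`.

Linked pairs are never matched in a stable matching (`notMem_of_low`), so within a class either all
men have their first choices or all have their last ones. Let `D` be the set of vertices of the
second kind. A linked pair blocks exactly when the man's class is in `D` and the woman's is not, so
the stable matchings are the `matchingOf D` with `D` a lower set (`isStable_matchingOf`,
`exists_eq_matchingOf`). A rotation shifts exactly one class (`exists_eq_rot`), and eliminating it
adds the vertex to `D` (`eliminate_rot`). Hence the rotations are the vertices, and the rotations
eliminated on the way to `matchingOf D` are those of `D`, which gives the order of the poset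
(`realizes`).

The program numbers the ends of the edge `i` by `2i` and `2i+1`, so that links are found by adding
or subtracting one, and computes the cyclic neighbours by remembering the last agent seen at each
vertex. The correctness proof uses weakest preconditions for the loop-free pieces and counted
invariants for the loops (`runs_while`); `isIso_constructInstance` identifies the resulting instance
with the generic construction. -/

namespace StableMarriage

open Prefs

/-! ## Lists and circular lists -/

theorem better_nil {α : Type*} (a b : α) : ¬ Better ([] : List α) a b := by
  rintro ⟨i, j, -, h, -⟩
  simp at h

theorem better_cons {α : Type*} (x : α) (l : List α) (a b : α) :
    Better (x :: l) a b ↔ (a = x ∧ b ∈ l) ∨ Better l a b := by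
  constructor
  · rintro ⟨i, j, hij, hi, hj⟩
    obtain ⟨j, rfl⟩ : ∃ j', j = j' + 1 := ⟨j - 1, by omega⟩
    rw [List.getElem?_cons_succ] at hj
    cases i with
    | zero =>
      left
      simp only [List.getElem?_cons_zero, Option.some.injEq] at hi
      exact ⟨hi.symm, List.mem_of_getElem? hj⟩
    | succ i => exact .inr ⟨i, j, by omega, by simpa using hi, hj⟩
  · rintro (⟨rfl, hb⟩ | ⟨i, j, hij, hi, hj⟩)
    · obtain ⟨j, hj⟩ := List.mem_iff_getElem?.1 hb
      exact ⟨0, j + 1, by omega, by simp, by simpa using hj⟩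
    · exact ⟨i + 1, j + 1, by omega, by simpa using hi, by simpa using hj⟩

theorem better_cons_toList_concat {α : Type*} (x y : α) (o : Option α) (a b : α) :
    Better (x :: (o.toList ++ [y])) a b ↔ (a = x ∧ (o = some b ∨ b = y)) ∨ (o = some a ∧ b = y) := by
  cases o with
  | none => simp [better_cons, better_nil]
  | some z => simp [better_cons, better_nil, eq_comm]

theorem next_induction {α : Type*} [DecidableEq α] {l : List α} (hl : l.Nodup) {P : α → Prop}
    {x : α} (hx : x ∈ l) (h : P x) (step : ∀ y (hy : y ∈ l), P y → P (l.next y hy)) :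
    ∀ y ∈ l, P y := by
  obtain ⟨i, hi, rfl⟩ := List.getElem_of_mem hx
  have hpos : 0 < l.length := by omega
  have key : ∀ k, P (l[(i + k) % l.length]'(Nat.mod_lt _ hpos)) := by
    intro k
    induction k with
    | zero => simpa [Nat.mod_eq_of_lt hi] using h
    | succ k ih =>
      have := step _ (List.getElem_mem _) ih
      rw [List.next_getElem _ hl] at this
      simpa [Nat.add_assoc] using this
  intro y hy
  obtain ⟨j, hj, rfl⟩ := List.getElem_of_mem hy
  -- This number of steps leads from position `i` to position `j`; the summand `l.length` keeps the
  -- subtraction from being truncated.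
  have := key (j + l.length - i)
  have e : (i + (j + l.length - i)) % l.length = j := by
    rw [show i + (j + l.length - i) = j + l.length by omega, Nat.add_mod_right,
      Nat.mod_eq_of_lt hj]
  simpa [e] using this

theorem follows_mem {M W : Type*} [DecidableEq M] [DecidableEq W] {ρ : Cycle (M × W)}
    {x y : M × W} (h : Follows ρ x y) : x ∈ ρ ∧ y ∈ ρ := by
  obtain ⟨h, hx, rfl⟩ := h
  exact ⟨hx, Cycle.next_mem _ _ _ _⟩

theorem follows_unique {M W : Type*} [DecidableEq M] [DecidableEq W] {ρ : Cycle (M × W)}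
    {x y z : M × W} (h : Follows ρ x y) (h' : Follows ρ x z) : y = z := by
  obtain ⟨h, hx, rfl⟩ := h
  obtain ⟨h, hx, rfl⟩ := h'
  rfl

theorem follows_induction {M W : Type*} [DecidableEq M] [DecidableEq W] {ρ : Cycle (M × W)}
    (hρ : ρ.Nodup) {P : M × W → Prop} {x : M × W} (hx : x ∈ ρ) (h : P x)
    (step : ∀ y z, Follows ρ y z → P y → P z) : ∀ y ∈ ρ, P y := by
  rcases ρ with ⟨l⟩
  exact next_induction (l := l) hρ hx h fun y hy hP => step y _ ⟨hρ, hy, rfl⟩ hP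

/-- A circular list without repetitions is determined by the permutation it induces, unless it has
at most one element: then the permutation is the identity and the element is lost. -/
theorem cycle_eq_of_follows {M W : Type*} [DecidableEq M] [DecidableEq W] {ρ ρ' : Cycle (M × W)}
    (h : ρ.Nodup) (h' : ρ'.Nodup) (hn : ¬ ρ'.Subsingleton) (hmem : ∀ x, x ∈ ρ ↔ x ∈ ρ')
    (hf : ∀ x y, Follows ρ x y → Follows ρ' x y) : ρ = ρ' := by
  have : ρ.formPerm h = ρ'.formPerm h' := by
    ext1 x
    by_cases hx : x ∈ ρ
    · obtain ⟨h1, h2, h3⟩ := hf x _ ⟨h, hx, rfl⟩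
      rw [Cycle.formPerm_apply_mem_eq_next _ _ _ hx, ← h3,
        Cycle.formPerm_apply_mem_eq_next]
    · rw [Cycle.formPerm_eq_self_of_notMem _ _ _ hx,
        Cycle.formPerm_eq_self_of_notMem _ _ _ (fun h => hx ((hmem x).2 h))]
  exact (Cycle.formPerm_eq_formPerm_iff.1 this).resolve_right fun h => hn h.2

/-! ## The instance of a family of cyclic classes linked along the edges of a Hasse diagram -/

/-- The elements of `A` are partitioned into classes, one for each vertex, and every class has a
cyclic ordering; every edge of the Hasse diagram links an element of the class of its lower end
with one of the class of its upper end, and every element is linked at most once upwards and at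
most once downwards. -/
structure CyclicClasses (X A : Type*) [PartialOrder X] where
  own : A → X
  cyc : X → List A
  cyc_nodup : ∀ v, (cyc v).Nodup
  mem_cyc : ∀ {v a}, a ∈ cyc v ↔ own a = v
  two_le : ∀ v, 2 ≤ (cyc v).length
  low : A → Option A
  high : A → Option A
  high_eq : ∀ a b, high b = some a ↔ low a = some b
  covBy : ∀ a b, low a = some b → own b ⋖ own a
  exists_low : ∀ u v, u ⋖ v → ∃ a b, low a = some b ∧ own b = u ∧ own a = v

namespace CyclicClasses

variable {X A : Type*} [PartialOrder X]

theorem mem_cyc_own (C : CyclicClasses X A) (a : A) : a ∈ C.cyc (C.own a) := C.mem_cyc.2 rfl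

theorem own_lt_of_low (C : CyclicClasses X A) {a b : A} (h : C.low a = some b) :
    C.own b < C.own a := (C.covBy a b h).lt

theorem low_ne_self (C : CyclicClasses X A) {a b : A} (h : C.low a = some b) : b ≠ a := fun e =>
  (C.own_lt_of_low h).ne (congrArg C.own e)

variable [DecidableEq A] (C : CyclicClasses X A)

/-- The next element in the class of `a`. -/
def nxt (a : A) : A := (C.cyc (C.own a)).next a (C.mem_cyc_own a)

/-- The previous element in the class of `a`. -/
def prv (a : A) : A := (C.cyc (C.own a)).prev a (C.mem_cyc_own a)

theorem nxt_eq {v : X} {a : A} (h : a ∈ C.cyc v) : C.nxt a = (C.cyc v).next a h := by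
  obtain rfl := C.mem_cyc.1 h
  rfl

theorem prv_eq {v : X} {a : A} (h : a ∈ C.cyc v) : C.prv a = (C.cyc v).prev a h := by
  obtain rfl := C.mem_cyc.1 h
  rfl

@[simp] theorem own_nxt (a : A) : C.own (C.nxt a) = C.own a := C.mem_cyc.1 (List.next_mem _ _ _)

@[simp] theorem own_prv (a : A) : C.own (C.prv a) = C.own a := C.mem_cyc.1 (List.prev_mem _ _ _)

@[simp] theorem prv_nxt (a : A) : C.prv (C.nxt a) = a := by
  exact (C.prv_eq (List.next_mem (C.cyc (C.own a)) a (C.mem_cyc_own a))).trans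
    (List.prev_next _ (C.cyc_nodup _) _ _)

@[simp] theorem nxt_prv (a : A) : C.nxt (C.prv a) = a := by
  exact (C.nxt_eq (List.prev_mem (C.cyc (C.own a)) a (C.mem_cyc_own a))).trans
    (List.next_prev _ (C.cyc_nodup _) _ _)

theorem nxt_ne (a : A) : C.nxt a ≠ a := by
  unfold nxt
  rw [← List.formPerm_apply_mem_eq_next (C.cyc_nodup _)]
  exact (List.formPerm_apply_mem_ne_self_iff _ (C.cyc_nodup _) a (C.mem_cyc_own a)).2 (C.two_le _)

theorem nxt_eq_iff {a b : A} : C.nxt a = b ↔ a = C.prv b := by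
  constructor <;> rintro rfl <;> simp

theorem induction_nxt {P : A → Prop} {a : A} (h : P a)
    (step : ∀ b, C.own b = C.own a → P b → P (C.nxt b)) : ∀ b, C.own b = C.own a → P b := by
  intro b hb
  refine next_induction (C.cyc_nodup (C.own a)) (C.mem_cyc_own a) h ?_ b (C.mem_cyc.2 hb)
  intro y hy hP
  rw [← C.nxt_eq]
  exact step y (C.mem_cyc.1 hy) hP

theorem induction_prv {P : A → Prop} {a : A} (h : P a)
    (step : ∀ b, C.own b = C.own a → P b → P (C.prv b)) : ∀ b, C.own b = C.own a → P b := by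
  intro b hb
  by_contra hPb
  refine C.induction_nxt (P := fun x => ¬ P x) hPb (fun c hc hPc hn => hPc ?_) a hb.symm h
  simpa using step (C.nxt c) (by simp [hc, hb]) hn

/-- Every man has his own woman first, then the women linked to him downwards, then the next
woman; the lists of the women are those lists reversed. -/
def prefs : Prefs A A where
  men a := a :: ((C.low a).toList ++ [C.nxt a])
  women a := C.prv a :: ((C.high a).toList ++ [a])

theorem better_men {m w w' : A} : Better (C.prefs.men m) w w' ↔
    (w = m ∧ (C.low m = some w' ∨ w' = C.nxt m)) ∨ (C.low m = some w ∧ w' = C.nxt m) :=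
  better_cons_toList_concat _ _ _ _ _

theorem better_women {m m' w : A} : Better (C.prefs.women w) m m' ↔
    (m = C.prv w ∧ (C.low m' = some w ∨ m' = w)) ∨ (C.low m = some w ∧ m' = w) := by
  rw [← C.high_eq, ← C.high_eq]
  exact better_cons_toList_concat _ _ _ _ _

theorem low_ne_nxt {a b : A} (h : C.low a = some b) : b ≠ C.nxt a := fun e =>
  (C.own_lt_of_low h).ne (by rw [e, own_nxt])

theorem mem_men {m w : A} : w ∈ C.prefs.men m ↔ w = m ∨ C.low m = some w ∨ w = C.nxt m := by
  simp [prefs]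

theorem mem_women {m w : A} : m ∈ C.prefs.women w ↔ w = C.nxt m ∨ C.low m = some w ∨ w = m := by
  simp [prefs, ← C.high_eq, eq_comm (a := w), C.nxt_eq_iff]

theorem acceptable {m w : A} :
    C.prefs.Acceptable m w ↔ w = m ∨ C.low m = some w ∨ w = C.nxt m := by
  rw [Prefs.Acceptable, mem_men, mem_women]
  tauto

theorem men_nodup (m : A) : (C.prefs.men m).Nodup := by
  have h := C.nxt_ne m
  cases hl : C.low m with
  | none => simp [prefs, hl, h.symm]
  | some b => simp [prefs, hl, h.symm, C.low_ne_nxt hl, (C.low_ne_self hl).symm]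

theorem women_nodup (w : A) : (C.prefs.women w).Nodup := by
  have h : C.prv w ≠ w := fun e => C.nxt_ne w (by rw [nxt_eq_iff, e])
  cases hl : C.high w with
  | none => simp [prefs, hl, h]
  | some b =>
    have hb := (C.high_eq _ _).1 hl
    simp only [prefs, hl, Option.toList_some, List.singleton_append, List.nodup_cons,
      List.mem_cons, List.not_mem_nil, not_or, or_false, not_false_eq_true]
    refine ⟨⟨?_, h⟩, (C.low_ne_self hb).symm, trivial, List.nodup_nil⟩
    intro e
    exact C.low_ne_nxt hb (by rw [← e, nxt_prv])

/-! ### Stable matchings -/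

section Stable

variable {C} {μ : Set (A × A)}

theorem not_better_own {a m : A} : ¬ Better (C.prefs.women a) a m := by
  rw [better_women]
  rintro (⟨h, -⟩ | ⟨h, -⟩)
  · exact C.nxt_ne a (C.nxt_eq_iff.2 h)
  · exact C.low_ne_self h rfl

theorem not_better_nxt {a w : A} : ¬ Better (C.prefs.men a) (C.nxt a) w := by
  rw [better_men]
  rintro (⟨h, -⟩ | ⟨h, -⟩)
  · exact C.nxt_ne a h
  · exact C.low_ne_nxt h rfl

/-- An unmatched man `m` would block with woman `nxt m`, who ranks him first. -/
theorem men_matched (h : C.prefs.IsStable μ) (m : A) : ∃ w, (m, w) ∈ μ := by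
  by_contra! hm
  refine h.2 m (C.nxt m) ⟨C.acceptable.2 (by simp), .inl hm, ?_⟩
  by_cases hw : ∀ m', (m', C.nxt m) ∉ μ
  · exact .inl hw
  · push Not at hw
    obtain ⟨m', hm'⟩ := hw
    refine .inr ⟨m', hm', ?_⟩
    have := C.acceptable.1 (h.1.acceptable _ _ hm')
    rw [better_women]
    simp only [prv_nxt, true_and]
    rcases this with e | e | e
    · exact .inl (.inr e.symm)
    · exact .inl (.inl e)
    · have : m' = m := by simpa using (congrArg C.prv e).symm
      exact (hm _ (this ▸ hm')).elim

/-- An unmatched woman `w` would block with man `w`, who ranks her first. -/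
theorem women_matched (h : C.prefs.IsStable μ) (w : A) : ∃ m, (m, w) ∈ μ := by
  by_contra! hw
  refine h.2 w w ⟨C.acceptable.2 (by simp), ?_, .inl hw⟩
  obtain ⟨w', hw'⟩ := men_matched h w
  refine .inr ⟨w', hw', ?_⟩
  rw [better_men]
  rcases C.acceptable.1 (h.1.acceptable _ _ hw') with rfl | e | e
  · exact (hw _ hw').elim
  · exact .inl ⟨rfl, .inl e⟩
  · exact .inl ⟨rfl, .inr e⟩

variable (C)

theorem isSMInstance : C.prefs.IsSMInstance where
  men_nodup := C.men_nodup
  women_nodup := C.women_nodup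
  consistent m w := by
    rw [mem_men, mem_women]
    tauto
  men_matched _ h := men_matched h
  women_matched _ h := women_matched h

/-- The matching in which the men of the classes in `D` are matched to their last choices, and all
other men to their first choices. -/
def matchingOf (D : Set X) : Set (A × A) :=
  {x | (C.own x.1 ∈ D ∧ x.2 = C.nxt x.1) ∨ (C.own x.1 ∉ D ∧ x.2 = x.1)}

variable {C} {D : Set X}

theorem mem_matchingOf {m w : A} : (m, w) ∈ C.matchingOf D ↔
    (C.own m ∈ D ∧ w = C.nxt m) ∨ (C.own m ∉ D ∧ w = m) := Iff.rfl

theorem mem_matchingOf_woman {m w : A} : (m, w) ∈ C.matchingOf D ↔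
    (C.own w ∈ D ∧ m = C.prv w) ∨ (C.own w ∉ D ∧ m = w) := by
  rw [mem_matchingOf]
  constructor <;> rintro (⟨h, rfl⟩ | ⟨h, rfl⟩) <;> simp [h]

/-- A pair in which one agent is the last choice of the other cannot block, which leaves the linked
pairs. For such a pair to block, the man's class must be in `D` and the woman's, which lies below
it, must not. -/
theorem isStable_matchingOf (hD : IsLowerSet D) : C.prefs.IsStable (C.matchingOf D) := by
  refine ⟨⟨?_, ?_, ?_⟩, ?_⟩
  · rintro m w (⟨-, h⟩ | ⟨-, h⟩)
    · exact C.acceptable.2 (.inr (.inr h))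
    · exact C.acceptable.2 (.inl h)
  · intro m w w' h h'
    rw [mem_matchingOf] at h h'
    grind
  · intro m m' w h h'
    rw [mem_matchingOf_woman] at h h'
    grind
  · rintro m w ⟨hacc, hm, hw⟩
    have hm : ∃ w', (m, w') ∈ C.matchingOf D ∧ Better (C.prefs.men m) w w' := by
      refine hm.resolve_left fun h => ?_
      by_cases hD : C.own m ∈ D
      · exact h _ (mem_matchingOf.2 (.inl ⟨hD, rfl⟩))
      · exact h _ (mem_matchingOf.2 (.inr ⟨hD, rfl⟩))
    have hw : ∃ m', (m', w) ∈ C.matchingOf D ∧ Better (C.prefs.women w) m m' := by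
      refine hw.resolve_left fun h => ?_
      by_cases hD : C.own w ∈ D
      · exact h _ (mem_matchingOf_woman.2 (.inl ⟨hD, rfl⟩))
      · exact h _ (mem_matchingOf_woman.2 (.inr ⟨hD, rfl⟩))
    obtain ⟨w', hw', hbm⟩ := hm
    obtain ⟨m', hm', hbw⟩ := hw
    rcases C.acceptable.1 hacc with rfl | e | rfl
    · exact not_better_own hbw
    · rw [better_men] at hbm
      rw [better_women] at hbw
      have h1 := C.low_ne_self e
      have h2 := C.low_ne_nxt e
      have hw'' : w' = C.nxt m := by tauto
      have hm'' : m' = w := by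
        rcases hbw with ⟨h, -⟩ | ⟨-, h⟩
        · exact (h2 (by rw [h, nxt_prv])).elim
        · exact h
      subst hw'' hm''
      have a1 : C.own m ∈ D := by
        rcases mem_matchingOf.1 hw' with ⟨h, -⟩ | ⟨-, h⟩
        · exact h
        · exact (C.nxt_ne m h).elim
      have a2 : C.own m' ∉ D := by
        rcases mem_matchingOf.1 hm' with ⟨-, h⟩ | ⟨h, -⟩
        · exact (C.nxt_ne m' h.symm).elim
        · exact h
      exact a2 (hD (C.own_lt_of_low e).le a1)
    · exact not_better_nxt hbm

/-- This needs classes with at least two elements: in a class of one element the first and the last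
choice would coincide. -/
theorem matchingOf_injective : Function.Injective (C.matchingOf) := by
  intro D D' h
  ext v
  obtain ⟨a, ha⟩ := List.exists_mem_of_length_pos (lt_of_lt_of_le two_pos (C.two_le v))
  obtain rfl := C.mem_cyc.1 ha
  have key : ∀ D, C.own a ∈ D ↔ (a, C.nxt a) ∈ C.matchingOf D := by
    intro D
    rw [mem_matchingOf]
    have := C.nxt_ne a
    tauto
  rw [key, key, h]

end Stable

end CyclicClasses

theorem isLowerSet_of_covBy {X : Type*} [PartialOrder X] [Finite X] {D : Set X}
    (h : ∀ u v, u ⋖ v → v ∈ D → u ∈ D) : IsLowerSet D := by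
  intro a
  induction a using WellFoundedLT.induction with
  | ind a ih =>
    intro b hb ha
    rcases hb.eq_or_lt with rfl | hlt
    · exact ha
    · obtain ⟨z, hbz, hz⟩ := exists_le_covBy_of_lt hlt
      exact ih z hz.lt hbz (h _ _ hz ha)

theorem next_map {α β : Type*} [DecidableEq α] [DecidableEq β] {f : α → β} {l : List α}
    (hl : (l.map f).Nodup) {x : α} (hx : x ∈ l) :
    (l.map f).next (f x) (List.mem_map_of_mem hx) = f (l.next x hx) := by
  obtain ⟨i, hi, rfl⟩ := List.getElem_of_mem hx
  have := List.next_getElem _ hl i (by simpa using hi)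
  simp only [List.getElem_map] at this
  rw [this, List.next_getElem _ hl.of_map]
  simp

theorem prev_map {α β : Type*} [DecidableEq α] [DecidableEq β] {f : α → β} {l : List α}
    (hl : (l.map f).Nodup) {x : α} (hx : x ∈ l) :
    (l.map f).prev (f x) (List.mem_map_of_mem hx) = f (l.prev x hx) := by
  obtain ⟨i, hi, rfl⟩ := List.getElem_of_mem hx
  have := List.prev_getElem _ hl i (by simpa using hi)
  simp only [List.getElem_map] at this
  rw [this, List.prev_getElem _ hl.of_map]
  simp

/-! ### Stable matchings correspond to lower sets -/

namespace CyclicClasses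

variable {X A : Type*} [PartialOrder X] {C : CyclicClasses X A} {μ : Set (A × A)} {D : Set X}

variable (C) in
/-- The rotation that moves the men of the class of `v` from their own women to the next ones. -/
def rot (v : X) : Cycle (A × A) := ((C.cyc v).map fun a => (a, a) : List (A × A))

theorem mem_rot {v : X} {x : A × A} : x ∈ C.rot v ↔ C.own x.1 = v ∧ x.2 = x.1 := by
  rcases x with ⟨a, b⟩
  simp only [rot, Cycle.mem_coe_iff, List.mem_map, Prod.mk.injEq, C.mem_cyc]
  constructor
  · rintro ⟨a, h, rfl, rfl⟩
    exact ⟨h, rfl⟩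
  · rintro ⟨h, rfl⟩
    exact ⟨_, h, rfl, rfl⟩

variable (C) in
theorem nodup_map_cyc (v : X) : ((C.cyc v).map fun a => (a, a)).Nodup :=
  (C.cyc_nodup v).map fun _ _ h => (Prod.mk.inj h).1

variable (C) in
theorem nodup_rot (v : X) : (C.rot v).Nodup := C.nodup_map_cyc v

theorem not_subsingleton_rot (v : X) : ¬ (C.rot v).Subsingleton := by
  have := C.two_le v
  rw [Cycle.length_subsingleton_iff]
  simp only [rot, Cycle.length_coe, List.length_map]
  omega

theorem rot_injective : Function.Injective C.rot := by
  intro u v h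
  obtain ⟨a, ha⟩ := List.exists_mem_of_length_pos (lt_of_lt_of_le two_pos (C.two_le u))
  have : (a, a) ∈ C.rot u := mem_rot.2 ⟨C.mem_cyc.1 ha, rfl⟩
  rw [h, mem_rot] at this
  rw [← this.1, ← C.mem_cyc.1 ha]

variable [DecidableEq A]

/-- Induction from the top of the poset. If man `a` had his linked woman, then woman `a` could have
neither man `a` nor, by induction, a man linked to her from above; so she has man `prv a`. Then
woman `prv a` has lost her own man as well, and so on backwards round the class, until woman `nxt a`
must have man `a`, who is already taken. -/
theorem notMem_of_low [Finite X] (h : C.prefs.IsStable μ) {a b : A} (hab : C.low a = some b) :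
    (a, b) ∉ μ := by
  suffices H : ∀ v a b, C.own a = v → C.low a = some b → (a, b) ∉ μ from H _ a b rfl hab
  intro v
  induction v using WellFoundedGT.induction with
  | ind v ih =>
    rintro a b rfl hab hμ
    have key : ∀ c, C.own c = C.own a → (c, c) ∉ μ → (C.prv c, c) ∈ μ := by
      intro c hc hcc
      obtain ⟨m, hm⟩ := women_matched h c
      rcases C.acceptable.1 (h.1.acceptable _ _ hm) with rfl | e | rfl
      · exact (hcc hm).elim
      · exact (ih (C.own m) (hc ▸ C.own_lt_of_low e) m c rfl e hm).elim
      · simpa using hm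
    have h1 : (C.prv a, a) ∈ μ :=
      key a rfl fun haa => C.low_ne_self hab (h.1.man_unique _ _ _ hμ haa)
    have h2 := C.induction_prv (P := fun c => (C.prv c, c) ∈ μ) h1 (by
      intro c hc hP
      refine key _ (by simpa) fun hcc => ?_
      exact C.nxt_ne c (C.nxt_eq_iff.2 (h.1.man_unique _ _ _ hP hcc))) (C.nxt a) (by simp)
    rw [prv_nxt] at h2
    exact C.low_ne_nxt hab (h.1.man_unique _ _ _ hμ h2)

/-- Once a man of a class has his last choice, the next man has lost his own woman and must take his
last choice too, and so on round the class. The classes that have moved form a lower set, since a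
violated cover relation contains a link, and that link blocks. -/
theorem exists_eq_matchingOf [Finite X] (h : C.prefs.IsStable μ) :
    ∃ D, IsLowerSet D ∧ μ = C.matchingOf D := by
  have hor : ∀ {m w}, (m, w) ∈ μ → w = m ∨ w = C.nxt m := by
    intro m w hm
    rcases C.acceptable.1 (h.1.acceptable _ _ hm) with e | e | e
    · exact .inl e
    · exact (notMem_of_low h e hm).elim
    · exact .inr e
  have hnxt : ∀ a, (a, C.nxt a) ∈ μ → ∀ b, C.own b = C.own a → (b, C.nxt b) ∈ μ := by
    intro a ha
    refine C.induction_nxt ha fun c _ hc => ?_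
    obtain ⟨w, hw⟩ := men_matched h (C.nxt c)
    rcases hor hw with rfl | rfl
    · exact (C.nxt_ne c (h.1.woman_unique _ _ _ hw hc)).elim
    · exact hw
  have hown : ∀ a, (∃ b, C.own b = C.own a ∧ (b, C.nxt b) ∈ μ) ↔ (a, C.nxt a) ∈ μ :=
    fun a => ⟨fun ⟨b, hb, hm⟩ => hnxt b hm a hb.symm, fun h => ⟨a, rfl, h⟩⟩
  refine ⟨{v | ∃ b, C.own b = v ∧ (b, C.nxt b) ∈ μ}, ?_, ?_⟩
  · refine isLowerSet_of_covBy fun u v huv hv => ?_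
    obtain ⟨a, b, hab, rfl, rfl⟩ := C.exists_low u v huv
    have ha : (a, C.nxt a) ∈ μ := (hown a).1 hv
    refine (hown b).2 ?_
    by_contra hb
    have hbb : (b, b) ∈ μ := by
      obtain ⟨w, hw⟩ := women_matched h b
      rcases hor hw with rfl | e
      · exact hw
      · obtain ⟨w', hw'⟩ := men_matched h b
        rcases hor hw' with rfl | rfl
        · exact hw'
        · exact (hb hw').elim
    refine h.2 a b ⟨C.acceptable.2 (.inr (.inl hab)), .inr ⟨_, ha, ?_⟩, .inr ⟨_, hbb, ?_⟩⟩
    · exact C.better_men.2 (.inr ⟨hab, rfl⟩)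
    · exact C.better_women.2 (.inr ⟨hab, rfl⟩)
  · ext ⟨m, w⟩
    rw [mem_matchingOf, Set.mem_ofPred_eq, hown]
    constructor
    · intro hm
      rcases hor hm with rfl | rfl
      · refine .inr ⟨fun h' => C.nxt_ne _ (h.1.man_unique _ _ _ h' hm), rfl⟩
      · exact .inl ⟨hm, rfl⟩
    · rintro (⟨hm, rfl⟩ | ⟨hm, rfl⟩)
      · exact hm
      · obtain ⟨w', hw'⟩ := men_matched h w
        rcases hor hw' with rfl | rfl
        · exact hw'
        · exact (hm hw').elim

/-! ### Rotations -/

theorem follows_rot {v : X} {x y : A × A} : Follows (C.rot v) x y ↔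
    ∃ a, C.own a = v ∧ x = (a, a) ∧ y = (C.nxt a, C.nxt a) := by
  have key : ∀ a (ha : C.own a = v), Follows (C.rot v) (a, a) (C.nxt a, C.nxt a) := by
    intro a ha
    have ha' := C.mem_cyc.2 ha
    refine ⟨C.nodup_rot v, mem_rot.2 ⟨ha, rfl⟩, ?_⟩
    rw [C.nxt_eq ha']
    exact next_map (C.nodup_map_cyc v) ha'
  constructor
  · intro h
    obtain ⟨hx, hx'⟩ := mem_rot.1 (follows_mem h).1
    rcases x with ⟨a, b⟩
    dsimp only at hx hx'
    subst hx'
    exact ⟨_, hx, rfl, follows_unique h (key _ hx)⟩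
  · rintro ⟨a, ha, rfl, rfl⟩
    exact key a ha

/-- This is how a link enforces the order: man `a` passes over woman `b` on his way to `nxt a` only
after the class of `b` has moved. -/
theorem prefersToPartner_low {a b : A} (h : C.low a = some b) :
    C.prefs.PrefersToPartner (C.matchingOf D) b a ↔ C.own b ∉ D := by
  have h1 : a ≠ C.prv b := by
    rintro rfl
    exact C.low_ne_nxt h (by simp)
  have h2 := C.low_ne_self h
  simp only [PrefersToPartner, better_women, mem_matchingOf_woman]
  constructor
  · rintro ⟨m, ⟨h3, rfl⟩ | ⟨h3, rfl⟩, h4⟩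
    · have : C.prv b ≠ b := fun e => C.nxt_ne b (C.nxt_eq_iff.2 e.symm)
      tauto
    · exact h3
  · intro h3
    exact ⟨b, .inr ⟨h3, rfl⟩, .inr ⟨h, rfl⟩⟩

theorem prefersToPartner_nxt {a : A} :
    C.prefs.PrefersToPartner (C.matchingOf D) (C.nxt a) a ↔ C.own a ∉ D := by
  simp only [PrefersToPartner, better_women, mem_matchingOf_woman]
  simp only [own_nxt, prv_nxt]
  constructor
  · rintro ⟨m, ⟨h3, rfl⟩ | ⟨h3, rfl⟩, h4⟩
    · have := C.nxt_ne m
      rcases h4 with ⟨-, h | h⟩ | ⟨-, h⟩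
      · exact (C.low_ne_nxt h rfl).elim
      · exact (this h.symm).elim
      · exact (this h.symm).elim
    · exact h3
  · intro h3
    exact ⟨C.nxt a, .inr ⟨h3, rfl⟩, .inl ⟨trivial, .inr rfl⟩⟩

theorem isExposed_rot (hD : IsLowerSet D) {v : X} (hv : v ∉ D) (hlt : ∀ u < v, u ∈ D) :
    C.prefs.IsExposed (C.matchingOf D) (C.rot v) where
  stable := isStable_matchingOf hD
  ne_nil h := not_subsingleton_rot (C := C) v (by rw [h]; exact Cycle.subsingleton_nil)
  nodup := C.nodup_rot v
  subset x hx := by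
    obtain ⟨h, h'⟩ := mem_rot.1 hx
    exact .inr ⟨by rwa [h], h'⟩
  next x y h := by
    obtain ⟨a, rfl, rfl, rfl⟩ := follows_rot.1 h
    refine ⟨C.better_men.2 (.inl ⟨rfl, .inr rfl⟩), prefersToPartner_nxt.2 hv, ?_⟩
    intro w h1 h2
    rcases C.better_men.1 h1 with ⟨-, h | rfl⟩ | ⟨h, -⟩
    · rw [prefersToPartner_low h, not_not]
      exact hlt _ (C.own_lt_of_low h)
    · exact (not_better_nxt h2).elim
    · exact (C.low_ne_self h rfl).elim

/-- All men of a rotation are at their first choices, since nobody comes after the last one. Each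
step either goes to the next agent of the same class or follows a link to a strictly lower class.
From a pair of minimal class only the first is possible, so the rotation stays in that class and
runs round all of it; and no man of it stops at a linked woman, so the lower neighbours have moved.
-/
theorem exists_eq_rot [Finite X] {ρ : Cycle (A × A)}
    (h : C.prefs.IsExposed (C.matchingOf D) ρ) :
    ∃ v, v ∉ D ∧ (∀ u, u ⋖ v → u ∈ D) ∧ ρ = C.rot v := by
  have hfirst : ∀ x ∈ ρ, C.own x.1 ∉ D ∧ x = (x.1, x.1) := by
    intro x hx
    rcases h.subset x hx with ⟨h1, h2⟩ | ⟨h1, h2⟩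
    · have := (h.next x _ ⟨h.nodup, hx, rfl⟩).1
      rw [h2] at this
      exact (not_better_nxt this).elim
    · exact ⟨h1, Prod.ext rfl h2⟩
  have hstep : ∀ x y, Follows ρ x y → (y = (C.nxt x.1, C.nxt x.1) ∧
      ∀ b, C.low x.1 = some b → C.own b ∈ D) ∨ C.own y.1 < C.own x.1 := by
    intro x y hxy
    obtain ⟨h1, h2, h3⟩ := h.next x y hxy
    obtain ⟨hx, hy⟩ := follows_mem hxy
    obtain ⟨-, hx2⟩ := hfirst x hx
    obtain ⟨-, hy2⟩ := hfirst y hy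
    have hx3 : x.2 = x.1 := by rw [hx2]
    have hy3 : y.2 = y.1 := by rw [hy2]
    rw [hx3] at h1 h3
    rcases C.better_men.1 h1 with ⟨-, e | e⟩ | ⟨e, -⟩
    · right
      rw [← hy3]
      exact C.own_lt_of_low e
    · left
      refine ⟨by rw [hy2, ← hy3, e], fun b hb => ?_⟩
      have := h3 b (C.better_men.2 (.inl ⟨rfl, .inl hb⟩)) (C.better_men.2 (.inr ⟨hb, e⟩))
      rwa [prefersToPartner_low hb, not_not] at this
    · exact (C.low_ne_self e rfl).elim
  obtain ⟨x₀, hx₀⟩ : ∃ x, x ∈ ρ := by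
    rcases ρ with ⟨l⟩
    refine List.exists_mem_of_ne_nil l fun e => h.ne_nil ?_
    rw [e]
    rfl
  obtain ⟨v, ⟨x, hx, rfl⟩, hmin⟩ := WellFounded.has_min (wellFounded_lt (α := X))
    {v | ∃ x ∈ ρ, C.own x.1 = v} ⟨_, x₀, hx₀, rfl⟩
  have hnxt : ∀ y z, Follows ρ y z → C.own y.1 = C.own x.1 → z = (C.nxt y.1, C.nxt y.1) ∧
      ∀ b, C.low y.1 = some b → C.own b ∈ D := by
    intro y z hyz hy
    refine (hstep y z hyz).resolve_right fun hlt => ?_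
    exact hmin _ ⟨z, (follows_mem hyz).2, rfl⟩ (hy ▸ hlt)
  have hall : ∀ y ∈ ρ, C.own y.1 = C.own x.1 := by
    refine follows_induction h.nodup hx rfl fun y z hyz hy => ?_
    rw [(hnxt y z hyz hy).1, own_nxt, hy]
  have hclass : ∀ a, C.own a = C.own x.1 → (a, a) ∈ ρ := by
    refine C.induction_nxt ((hfirst x hx).2 ▸ hx) fun a ha hm => ?_
    have hf : Follows ρ (a, a) _ := ⟨h.nodup, hm, rfl⟩
    have := (follows_mem hf).2
    rwa [(hnxt _ _ hf ha).1] at this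
  refine ⟨C.own x.1, (hfirst x hx).1, ?_, ?_⟩
  · intro u hu
    obtain ⟨a, b, hab, rfl, ha⟩ := C.exists_low _ _ hu
    exact (hnxt _ _ ⟨h.nodup, hclass a ha, rfl⟩ ha).2 b hab
  · refine cycle_eq_of_follows h.nodup (C.nodup_rot _) (not_subsingleton_rot _) ?_ ?_
    · intro y
      rw [mem_rot]
      constructor
      · exact fun hy => ⟨hall y hy, congrArg Prod.snd (hfirst y hy).2⟩
      · rintro ⟨h1, h2⟩
        have := hclass _ h1
        rwa [← show y = (y.1, y.1) from Prod.ext rfl h2] at this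
    · intro y z hyz
      have hy := (follows_mem hyz).1
      exact follows_rot.2 ⟨y.1, hall y hy, (hfirst y hy).2, (hnxt y z hyz (hall y hy)).1⟩

theorem eliminate_rot {v : X} :
    eliminate (C.matchingOf D) (C.rot v) = C.matchingOf (insert v D) := by
  ext ⟨m, w⟩
  simp only [eliminate, Set.mem_union, Set.mem_sdiff, Set.mem_ofPred_eq, follows_rot, mem_rot,
    mem_matchingOf, Set.mem_insert_iff]
  have hn := C.nxt_ne m
  have : (∃ x y, (∃ a, C.own a = v ∧ x = (a, a) ∧ y = (C.nxt a, C.nxt a)) ∧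
      (m, w) = (x.1, y.2)) ↔ C.own m = v ∧ w = C.nxt m := by
    constructor
    · rintro ⟨x, y, ⟨a, h, rfl, rfl⟩, e⟩
      simp only [Prod.mk.injEq] at e
      obtain ⟨rfl, rfl⟩ := e
      exact ⟨h, rfl⟩
    · rintro ⟨h, rfl⟩
      exact ⟨_, _, ⟨m, h, rfl, rfl⟩, rfl⟩
  rw [this]
  have hv : C.own m = v → w = C.nxt m → w ≠ m := by
    rintro - rfl
    exact hn
  tauto

/-! ### The rotation poset -/

theorem eq_of_isManOptimal [Finite X] (h : C.prefs.IsManOptimal μ) : μ = C.matchingOf ∅ := by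
  obtain ⟨D, hD, rfl⟩ := exists_eq_matchingOf h.1
  congr 1
  refine Set.eq_empty_of_forall_notMem fun v hv => ?_
  obtain ⟨a, ha⟩ := List.exists_mem_of_length_pos (lt_of_lt_of_le two_pos (C.two_le v))
  obtain rfl := C.mem_cyc.1 ha
  rcases h.2 _ (isStable_matchingOf isLowerSet_empty) a (C.nxt a) a
    (mem_matchingOf.2 (.inl ⟨hv, rfl⟩)) (mem_matchingOf.2 (.inr ⟨id, rfl⟩)) with h | h
  · exact C.nxt_ne a h
  · exact not_better_nxt h

theorem isManOptimal_matchingOf_empty : C.prefs.IsManOptimal (C.matchingOf ∅) := by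
  refine ⟨isStable_matchingOf isLowerSet_empty, fun μ h m w w' hw hw' => ?_⟩
  obtain rfl : w = m := by
    rw [mem_matchingOf] at hw
    simpa using hw
  rcases C.acceptable.1 (h.1.acceptable _ _ hw') with e | e | e
  · exact .inl e.symm
  · exact .inr (C.better_men.2 (.inl ⟨rfl, .inl e⟩))
  · exact .inr (C.better_men.2 (.inl ⟨rfl, .inr e⟩))

/-- The eliminated set depends only on the matching reached, not on the order of elimination. -/
theorem eq_of_eliminatedTo [Finite X] {S : Set (Cycle (A × A))} (h : C.prefs.EliminatedTo S μ) :
    ∃ D, μ = C.matchingOf D ∧ S = C.rot '' D := by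
  induction h with
  | start h => exact ⟨∅, eq_of_isManOptimal h, by simp⟩
  | step _ hexp ih =>
    obtain ⟨D, rfl, rfl⟩ := ih
    obtain ⟨v, -, -, rfl⟩ := exists_eq_rot hexp
    exact ⟨insert v D, eliminate_rot, by rw [Set.image_insert_eq]⟩

theorem eliminatedTo_matchingOf [Finite X] (hD : IsLowerSet D) :
    C.prefs.EliminatedTo (C.rot '' D) (C.matchingOf D) := by
  induction hn : D.ncard generalizing D with
  | zero =>
    rw [Set.ncard_eq_zero] at hn
    subst hn
    rw [Set.image_empty]
    exact .start isManOptimal_matchingOf_empty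
  | succ n ih =>
    have hne : D.Nonempty := Set.nonempty_of_ncard_ne_zero (by omega)
    -- Minimal for `>`, that is, a maximal element of `D`: removing it leaves a lower set, and its
    -- rotation can be eliminated last.
    obtain ⟨v, hv, hmax⟩ := WellFounded.has_min (wellFounded_gt (α := X)) D hne
    have hlow : IsLowerSet (D \ {v}) := by
      rintro a b hba ⟨ha, hav⟩
      refine ⟨hD hba ha, ?_⟩
      rintro rfl
      exact hmax a ha (lt_of_le_of_ne hba fun e => hav e.symm)
    have := (ih hlow (by rw [Set.ncard_sdiff_singleton_of_mem hv]; omega)).step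
      (isExposed_rot hlow (v := v) (by simp) fun u hu => ⟨hD hu.le hv, hu.ne⟩)
    rwa [eliminate_rot, ← Set.image_insert_eq, Set.insert_sdiff_singleton,
      Set.insert_eq_of_mem hv] at this

variable (C) in
theorem realizes [Finite X] : C.prefs.Realizes X := by
  have hrot : ∀ v, C.prefs.IsExposed (C.matchingOf (Set.Iio v)) (C.rot v) := fun v =>
    isExposed_rot (isLowerSet_Iio v) (by simp) fun u hu => hu
  refine ⟨Equiv.ofBijective (fun v => ⟨C.rot v, _, hrot v⟩) ⟨?_, ?_⟩, ?_⟩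
  · exact fun u v h => rot_injective (Subtype.ext_iff.1 h)
  · rintro ⟨ρ, μ, hρ⟩
    obtain ⟨D, -, rfl⟩ := exists_eq_matchingOf hρ.stable
    obtain ⟨v, -, -, rfl⟩ := exists_eq_rot hρ
    exact ⟨v, rfl⟩
  · intro x y
    change x < y ↔ C.prefs.Precedes (C.rot x) (C.rot y)
    constructor
    · intro hxy μ hμ
      obtain ⟨D, hD, rfl⟩ := exists_eq_matchingOf hμ.stable
      obtain ⟨v, -, hcov, hv⟩ := exists_eq_rot hμ
      obtain rfl := rot_injective hv
      obtain ⟨z, hxz, hz⟩ := exists_le_covBy_of_lt hxy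
      exact ⟨_, eliminatedTo_matchingOf hD, x, hD hxz (hcov z hz), rfl⟩
    · intro h
      -- Test with the smallest lower set at which the rotation of `y` is exposed, the elements
      -- strictly below `y`.
      obtain ⟨S, hS, hx⟩ := h _ (hrot y)
      obtain ⟨D, hD, rfl⟩ := eq_of_eliminatedTo hS
      obtain ⟨u, hu, e⟩ := hx
      obtain rfl := rot_injective e
      obtain rfl := matchingOf_injective hD
      exact hu

end CyclicClasses

namespace RAM

/-! ## Reasoning about programs -/

/-- An upper bound for the number of steps of a program without loops. -/
def Prog.size : Prog → ℕ
  | .skip => 1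
  | .assign _ e => e.cost + 1
  | .store _ i e => i.cost + e.cost + 1
  | .read _ => 1
  | .write e => e.cost + 1
  | .seq P Q => P.size + Q.size
  | .ifLt e₁ e₂ P Q => e₁.cost + e₂.cost + 1 + (P.size + Q.size)
  | .whileLt _ _ _ => 0

/-- The weakest precondition of a program without loops. -/
def wp : Prog → State → (State → Prop) → Prop
  | .skip, s, Q => Q s
  | .assign x e, s, Q => Q { s with var := Function.update s.var x (e.eval s) }
  | .store a i e, s, Q =>
      Q { s with arr := Function.update s.arr a (Function.update (s.arr a) (i.eval s) (e.eval s)) }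
  | .read x, s, Q => ∃ n l, s.input = n :: l ∧
      Q { s with var := Function.update s.var x n, input := l }
  | .write e, s, Q => Q { s with output := s.output ++ [e.eval s] }
  | .seq P R, s, Q => wp P s fun s' => wp R s' Q
  | .ifLt e₁ e₂ P R, s, Q => if e₁.eval s < e₂.eval s then wp P s Q else wp R s Q
  | .whileLt _ _ _, _, _ => False

/-- Started in `s`, the program `P` halts after at most `T` steps in a state that satisfies `Q`. -/
def Runs (P : Prog) (s : State) (T : ℕ) (Q : State → Prop) : Prop :=
  ∃ t s', Exec P s t s' ∧ t ≤ T ∧ Q s'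

theorem wp_mono {P : Prog} {s : State} {Q Q' : State → Prop} (h : wp P s Q)
    (hQ : ∀ s, Q s → Q' s) : wp P s Q' := by
  induction P generalizing s Q Q' with
  | skip => exact hQ _ h
  | assign => exact hQ _ h
  | store => exact hQ _ h
  | write => exact hQ _ h
  | read =>
    obtain ⟨n, l, h1, h2⟩ := h
    exact ⟨n, l, h1, hQ _ h2⟩
  | seq P R ihP ihR => exact ihP h fun s' h' => ihR h' hQ
  | ifLt e₁ e₂ P R ihP ihR =>
    unfold wp at h ⊢
    split_ifs at h ⊢
    · exact ihP h hQ
    · exact ihR h hQ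
  | whileLt => exact h.elim

/-- The value 0 of `Prog.size` on loops does no harm, because the precondition `wp` of a loop is
`False`. -/
theorem runs_of_wp {P : Prog} {s : State} {Q : State → Prop} (h : wp P s Q) :
    Runs P s P.size Q := by
  induction P generalizing s Q with
  | skip => exact ⟨_, _, .skip s, le_rfl, h⟩
  | assign x e => exact ⟨_, _, .assign x e s, le_rfl, h⟩
  | store a i e => exact ⟨_, _, .store a i e s, le_rfl, h⟩
  | write e => exact ⟨_, _, .write e s, le_rfl, h⟩
  | read x =>
    obtain ⟨n, l, h1, h2⟩ := h
    exact ⟨_, _, .read x n l s h1, le_rfl, h2⟩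
  | seq P R ihP ihR =>
    obtain ⟨t, s', h1, h2, h3⟩ := ihP h
    obtain ⟨t', s'', h4, h5, h6⟩ := ihR h3
    exact ⟨_, _, .seq h1 h4, add_le_add h2 h5, h6⟩
  | ifLt e₁ e₂ P R ihP ihR =>
    unfold wp at h
    split_ifs at h with hc
    · obtain ⟨t, s', h1, h2, h3⟩ := ihP h
      exact ⟨_, _, .ifLt_true hc h1, by simp only [Prog.size]; omega, h3⟩
    · obtain ⟨t, s', h1, h2, h3⟩ := ihR h
      exact ⟨_, _, .ifLt_false hc h1, by simp only [Prog.size]; omega, h3⟩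
  | whileLt => exact h.elim

theorem Runs.seq {P R : Prog} {s : State} {T T' : ℕ} {Q Q' : State → Prop} (h : Runs P s T Q)
    (h' : ∀ s', Q s' → Runs R s' T' Q') : Runs (.seq P R) s (T + T') Q' := by
  obtain ⟨t, s', h1, h2, h3⟩ := h
  obtain ⟨t', s'', h4, h5, h6⟩ := h' _ h3
  exact ⟨_, _, .seq h1 h4, add_le_add h2 h5, h6⟩

theorem Runs.mono {P : Prog} {s : State} {T T' : ℕ} {Q Q' : State → Prop} (h : Runs P s T Q)
    (hT : T ≤ T') (hQ : ∀ s, Q s → Q' s) : Runs P s T' Q' := by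
  obtain ⟨t, s', h1, h2, h3⟩ := h
  exact ⟨t, s', h1, h2.trans hT, hQ _ h3⟩

theorem Runs.ifLt_pos {e₁ e₂ : Exp} {P R : Prog} {s : State} {T : ℕ} {Q : State → Prop}
    (hc : e₁.eval s < e₂.eval s) (h : Runs P s T Q) :
    Runs (.ifLt e₁ e₂ P R) s (e₁.cost + e₂.cost + 1 + T) Q := by
  obtain ⟨t, s', h1, h2, h3⟩ := h
  exact ⟨_, _, .ifLt_true hc h1, Nat.add_le_add_left h2 _, h3⟩

theorem Runs.ifLt_neg {e₁ e₂ : Exp} {P R : Prog} {s : State} {T : ℕ} {Q : State → Prop}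
    (hc : ¬ e₁.eval s < e₂.eval s) (h : Runs R s T Q) :
    Runs (.ifLt e₁ e₂ P R) s (e₁.cost + e₂.cost + 1 + T) Q := by
  obtain ⟨t, s', h1, h2, h3⟩ := h
  exact ⟨_, _, .ifLt_false hc h1, Nat.add_le_add_left h2 _, h3⟩

/-- The invariant is indexed by the number of completed passes. The body has no loops, so every pass
has the same cost bound and the total is linear in `N`. -/
theorem runs_while {e₁ e₂ : Exp} {P : Prog} {s : State} {N : ℕ} (Inv : ℕ → State → Prop)
    (hbody : ∀ k < N, ∀ s, Inv k s → e₁.eval s < e₂.eval s ∧ wp P s (Inv (k + 1)))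
    (hend : ∀ s, Inv N s → ¬ e₁.eval s < e₂.eval s) (h0 : Inv 0 s) :
    Runs (.whileLt e₁ e₂ P) s (N * (e₁.cost + e₂.cost + 1 + P.size) + (e₁.cost + e₂.cost + 1))
      (Inv N) := by
  suffices H : ∀ j k s, k + j = N → Inv k s → Runs (.whileLt e₁ e₂ P) s
      (j * (e₁.cost + e₂.cost + 1 + P.size) + (e₁.cost + e₂.cost + 1)) (Inv N) from
    H N 0 s (by omega) h0
  intro j
  induction j with
  | zero =>
    rintro k s rfl h
    exact ⟨_, _, .whileLt_false (hend s h), by omega, h⟩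
  | succ j ih =>
    intro k s hk h
    obtain ⟨hc, hP⟩ := hbody k (by omega) s h
    obtain ⟨t, s', h1, h2, h3⟩ := runs_of_wp hP
    obtain ⟨t', s'', h4, h5, h6⟩ := ih (k + 1) s' (by omega) h3
    refine ⟨_, _, .whileLt_true hc h1 h4, ?_, h6⟩
    rw [Nat.add_mul]
    omega

/-- Write the values of a list of expressions. -/
def writeAll : List Exp → Prog
  | [] => .skip
  | e :: es => .seq (.write e) (writeAll es)

theorem eval_output (s : State) (l : List ℕ) (e : Exp) :
    e.eval { s with output := l } = e.eval s := by
  induction e <;> simp_all [Exp.eval]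

theorem wp_writeAll {es : List Exp} {s : State} {Q : State → Prop}
    (h : Q { s with output := s.output ++ es.map (Exp.eval s) }) : wp (writeAll es) s Q := by
  induction es generalizing s with
  | nil => simpa [writeAll, wp] using h
  | cons e es ih =>
    refine ih ?_
    have : Exp.eval { s with output := s.output ++ [e.eval s] } = Exp.eval s :=
      funext (eval_output s _)
    simpa [this] using h

/-! ## The program

The variables `0`, `1`, `2` hold the number `p` of vertices, twice the number `q` of edges, and the
number of agents that have been created. The arrays `0`, `1`, `2` hold the vertex of an agent, the
agent of a vertex that was visited last, and the number of agents of a vertex; the arrays `3` and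
`4` hold the previous and the next agent at the same vertex. -/

/-- Create an agent at the vertex in the variable `x`. -/
def push (x : ℕ) : Prog :=
  .seq (.store 0 (.var 2) (.var x)) <|
  .seq (.store 1 (.var x) (.var 2)) <|
  .seq (.store 2 (.var x) (.add (.get 2 (.var x)) (.lit 1))) <|
  .assign 2 (.add (.var 2) (.lit 1))

/-- Read the edges, and create an agent for each end of an edge. -/
def readEdges : Prog :=
  .whileLt (.var 2) (.var 1) (.seq (.read 4) (push 4))

/-- Create an agent at every vertex that has less than `c` agents. -/
def pad (c : ℕ) : Prog :=
  .whileLt (.var 3) (.var 0) <|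
    .seq (.ifLt (.get 2 (.var 3)) (.lit c) (push 3) .skip) (.assign 3 (.add (.var 3) (.lit 1)))

/-- Link each agent with the previous one at the same vertex. -/
def link : Prog :=
  .whileLt (.var 3) (.var 2) <|
    .seq (.assign 4 (.get 0 (.var 3))) <|
    .seq (.store 3 (.var 3) (.get 1 (.var 4))) <|
    .seq (.store 4 (.get 1 (.var 4)) (.var 3)) <|
    .seq (.store 1 (.var 4) (.var 3)) <|
    .assign 3 (.add (.var 3) (.lit 1))

/-- Write `es` for every edge, and then `ps` for all other agents. -/
def writeLists (es ps : List Exp) : Prog :=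
  .seq (.whileLt (.var 3) (.var 1) (.seq (writeAll es) (.assign 3 (.add (.var 3) (.lit 2)))))
    (.whileLt (.var 3) (.var 2) (.seq (writeAll ps) (.assign 3 (.add (.var 3) (.lit 1)))))

def reset : Prog := .assign 3 (.lit 0)

/-- At the start of a pass for an edge, variable `3` is the agent at its lower end and its successor
is the agent at the upper end. Only the latter has a downward link as a man; in `writeWomen` only
the former has an upward link as a woman. -/
def writeMen : Prog :=
  writeLists
    [.lit 2, .var 3, .get 4 (.var 3),
      .lit 3, .add (.var 3) (.lit 1), .var 3, .get 4 (.add (.var 3) (.lit 1))]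
    [.lit 2, .var 3, .get 4 (.var 3)]

def writeWomen : Prog :=
  writeLists
    [.lit 3, .get 3 (.var 3), .add (.var 3) (.lit 1), .var 3,
      .lit 2, .get 3 (.add (.var 3) (.lit 1)), .add (.var 3) (.lit 1)]
    [.lit 2, .get 3 (.var 3), .var 3]

/-- A pass of `pad` adds at most one agent per vertex, so an isolated vertex needs both. Running
them separately also makes the colour of a padding agent visible from its number: 1 for the first
pass, 2 for the second. -/
def mainProg : Prog :=
  .seq readEdges <| .seq reset <| .seq (pad 1) <| .seq reset <| .seq (pad 2) <| .seq reset <|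
  .seq link <| .seq (.write (.var 2)) <| .seq reset <| .seq writeMen <| .seq reset writeWomen

/-- The empty poset is treated apart because an instance must have at least one man: `1, 1, 0, 1, 0`
encodes one man and one woman who list each other. -/
def prog : Prog :=
  .seq (.seq (.read 0) (.seq (.read 1) (.assign 1 (.add (.var 1) (.var 1)))))
    (.ifLt (.var 0) (.lit 1) (writeAll [.lit 1, .lit 1, .lit 0, .lit 1, .lit 0]) mainProg)

/-! ## What the program computes -/

/-- The last `a < k` with `o a = v`, and `d` if there is none. -/
def lastOcc (o : ℕ → ℕ) (d v : ℕ) : ℕ → ℕ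
  | 0 => d
  | k + 1 => if o k = v then k else lastOcc o d v k

theorem lastOcc_congr {o o' : ℕ → ℕ} {d v k : ℕ} (h : ∀ a < k, o a = o' a) :
    lastOcc o d v k = lastOcc o' d v k := by
  induction k with
  | zero => rfl
  | succ k ih => rw [lastOcc, lastOcc, h k (by omega), ih fun a ha => h a (by omega)]

/-- The last agent before `a`, in the cyclic order, at the same vertex. -/
def prevOcc (o : ℕ → ℕ) (n a : ℕ) : ℕ := lastOcc o (lastOcc o 0 (o a) n) (o a) a

/-- The list `F`, followed by the vertices that occur less than `c` times in it. -/
def padded (p c : ℕ) (F : List ℕ) : List ℕ := F ++ (List.range p).filter fun v => F.count v < c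

/-- The vertices of the agents. -/
def owners (p : ℕ) (F : List ℕ) : List ℕ := padded p 2 (padded p 1 F)

/-- The state of the program when agents with the vertices `S` have been created. -/
structure Built (p q : ℕ) (S inp : List ℕ) (s : State) : Prop where
  var0 : s.var 0 = p
  var1 : s.var 1 = q + q
  var2 : s.var 2 = S.length
  arr0 : s.arr 0 = fun a => S.getD a 0
  arr1 : s.arr 1 = fun v => lastOcc (fun a => S.getD a 0) 0 v S.length
  arr2 : s.arr 2 = fun v => S.count v
  input : s.input = inp
  output : s.output = []

theorem wp_push {p q : ℕ} {S inp : List ℕ} {s : State} (x v : ℕ) (h : Built p q S inp s)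
    (hx : s.var x = v) : wp (push x) s fun s' =>
      Built p q (S ++ [v]) inp s' ∧ ∀ y ≠ 2, s'.var y = s.var y := by
  obtain ⟨h0, h1, h2, h3, h4, h5, h6, h7⟩ := h
  have hg : ∀ a, (S ++ [v]).getD a 0 = if a = S.length then v else S.getD a 0 := by
    intro a
    rcases lt_trichotomy a S.length with h | h | h
    · simp [List.getD, List.getElem?_append_left h, h.ne]
    · simp [h]
    · simp [List.getD, h.le, h.ne', List.getElem?_append_right,
        List.getElem?_eq_none (show [v].length ≤ a - S.length by simp; omega)]
  simp only [push, wp, Exp.eval, hx]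
  refine ⟨⟨by simp [h0], by simp [h1], by simp [h2], ?_, ?_, ?_, h6, h7⟩, fun y hy => by simp [hy]⟩
  · funext a
    rw [hg]
    simp [h3, h2, Function.update_apply]
  · funext w
    simp only [List.length_append, List.length_singleton, lastOcc]
    have hl : lastOcc (fun a => (S ++ [v]).getD a 0) 0 w S.length =
        lastOcc (fun a => S.getD a 0) 0 w S.length :=
      lastOcc_congr fun a ha => by simp only [hg, ha.ne, if_false]
    rw [hl, hg]
    simp [h4, h2, Function.update_apply, eq_comm]
  · funext w
    rw [List.count_append, List.count_singleton]
    by_cases hw : w = v <;> simp [h5, hw, Ne.symm]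

theorem runs_readEdges {p q : ℕ} {F : List ℕ} {s : State} (hF : F.length = q + q)
    (h : Built p q [] F s) :
    Runs readEdges s ((q + q) * 20 + 3) (Built p q F []) := by
  refine (runs_while (N := q + q) (fun k s => Built p q (F.take k) (F.drop k) s) ?_ ?_ ?_).mono
    (by simp [push, Prog.size, Exp.cost]) (fun s hs => ?_)
  · intro k hk s hs
    have hkF : k < F.length := by omega
    refine ⟨?_, ?_⟩
    · simp [Exp.eval, hs.var1, hs.var2, hkF.le]
      omega
    · refine ⟨F[k], F.drop (k + 1), by rw [hs.input, List.drop_eq_getElem_cons hkF], ?_⟩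
      refine wp_mono (wp_push 4 F[k] (S := F.take k) (inp := F.drop (k + 1)) (p := p) (q := q)
        ⟨?_, ?_, ?_, hs.arr0, hs.arr1, hs.arr2, rfl, hs.output⟩ ?_) ?_
      · simp [hs.var0]
      · simp [hs.var1]
      · simp [hs.var2]
      · simp
      · rintro s ⟨hs, -⟩
        rwa [List.take_append_getElem] at hs
  · intro s hs
    simp [Exp.eval, hs.var1, hs.var2]
    omega
  · simpa using h
  · rw [← hF] at hs
    simpa using hs

theorem runs_pad {p q : ℕ} {F : List ℕ} {s : State} (c : ℕ) (h : Built p q F [] s)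
    (h3 : s.var 3 = 0) : Runs (pad c) s (p * 30 + 3) (Built p q (padded p c F) []) := by
  refine (runs_while (N := p) (fun k s => Built p q (padded k c F) [] s ∧ s.var 3 = k)
    ?_ ?_ ?_).mono (by simp only [push, Prog.size, Exp.cost]; omega) (fun s hs => hs.1)
  · rintro k hk s ⟨hs, h3⟩
    refine ⟨by simpa [Exp.eval, h3, hs.var0], ?_⟩
    -- The program tests the current count, whereas `padded` refers to the count in `F`. They agree
    -- at `k`, because only vertices smaller than `k` have been padded so far.
    have hcount : (padded k c F).count k = F.count k := by
      simp [padded, List.count_append, List.count_eq_zero]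
    have hsucc : padded (k + 1) c F = padded k c F ++ if F.count k < c then [k] else [] := by
      simp only [padded, List.range_succ, List.filter_append, List.append_assoc,
        List.filter_singleton]
      by_cases hc : F.count k < c <;> simp [hc]
    have hinc : ∀ {S : List ℕ} {s : State}, Built p q S [] s → s.var 3 = k →
        wp (.assign 3 (.add (.var 3) (.lit 1))) s
          (fun s => Built p q S [] s ∧ s.var 3 = k + 1) := by
      intro S s hs h3
      exact ⟨⟨by simp [hs.var0], by simp [hs.var1], by simp [hs.var2], hs.arr0, hs.arr1, hs.arr2,
        hs.input, hs.output⟩, by simp [Exp.eval, h3]⟩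
    simp only [wp.eq_6, wp.eq_7]
    have he : (Exp.get 2 (.var 3)).eval s < (Exp.lit c).eval s ↔ F.count k < c := by
      simp [Exp.eval, h3, hs.arr2, hcount]
    simp only [he]
    split_ifs with hc
    · refine wp_mono (wp_push 3 k hs h3) fun s' hs' => ?_
      rw [hsucc, if_pos hc]
      exact hinc hs'.1 (by rw [hs'.2 3 (by norm_num), h3])
    · rw [hsucc, if_neg hc, List.append_nil]
      exact hinc hs h3
  · rintro s ⟨hs, h3⟩
    simp [Exp.eval, h3, hs.var0]
  · exact ⟨by simpa [padded] using h, h3⟩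

theorem wp_reset {p q : ℕ} {S : List ℕ} {s : State} (h : Built p q S [] s) :
    wp reset s fun s => Built p q S [] s ∧ s.var 3 = 0 :=
  ⟨⟨by simp [h.var0], by simp [h.var1], by simp [h.var2], h.arr0, h.arr1, h.arr2,
    h.input, h.output⟩, by simp [Exp.eval]⟩

/-- The state of the program when the agents have been linked. -/
structure Linked (q n : ℕ) (o : ℕ → ℕ) (A : ℕ → ℕ → ℕ) (out : List ℕ) (s : State) : Prop where
  var1 : s.var 1 = q + q
  var2 : s.var 2 = n
  arr : s.arr = A
  output : s.output = out
  prev : ∀ a < n, A 3 a = prevOcc o n a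
  next : ∀ a < n, A 4 (prevOcc o n a) = a

/-- Array `1` still holds the last agent of each vertex when the pass begins. So the first agent
visited at a vertex is linked to the last one, which closes the cycle without special treatment. -/
theorem runs_link {p q : ℕ} {S : List ℕ} {s : State} (h : Built p q S [] s) (h3 : s.var 3 = 0)
    (hinj : ∀ a < S.length, ∀ b < S.length,
      prevOcc (fun a => S.getD a 0) S.length a = prevOcc (fun a => S.getD a 0) S.length b → a = b) :
    Runs link s (S.length * 25 + 3)
      (fun s => Linked q S.length (fun a => S.getD a 0) s.arr [] s) := by
  set o : ℕ → ℕ := fun a => S.getD a 0 with ho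
  set n := S.length with hn
  refine (runs_while (N := n) (fun k s => s.var 1 = q + q ∧ s.var 2 = n ∧ s.var 3 = k ∧
    s.output = [] ∧ s.arr 0 = o ∧ (s.arr 1 = fun v => lastOcc o (lastOcc o 0 v n) v k) ∧
    (∀ a < k, s.arr 3 a = prevOcc o n a) ∧ (∀ a < k, s.arr 4 (prevOcc o n a) = a)) ?_ ?_ ?_).mono
    (by simp only [Prog.size, Exp.cost]; omega) (fun s hs => ?_)
  · rintro k hk s ⟨h1, h2, h3, h4, h5, h6, h7, h8⟩
    refine ⟨by simpa [Exp.eval, h3, h2], ?_⟩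
    simp only [wp, Exp.eval]
    have hp : lastOcc o (lastOcc o 0 (o k) n) (o k) k = prevOcc o n k := rfl
    refine ⟨by simp [h1], by simp [h2], by simp [h3], h4, by simp [h5], ?_, ?_, ?_⟩
    · funext v
      simp [h3, h5, h6, Function.update_apply, lastOcc, eq_comm]
    · intro a ha
      simp only [h3, h5, h6, Function.update_apply]
      by_cases hak : a = k
      · simp [hak, hp]
      · simpa [hak] using h7 a (by omega)
    · intro a ha
      simp [h3, h5, h6, Function.update_apply]
      by_cases hak : a = k
      · simp [hak, hp]
      -- Distinct agents have distinct predecessors, so the new entry of array `4` does not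
      -- overwrite an earlier one.
      · have : prevOcc o n a ≠ prevOcc o n k := fun e => hak (hinj a (by omega) k hk e)
        rw [hp, if_neg this]
        exact h8 a (by omega)
  · rintro s ⟨-, h2, h3, -⟩
    simp [Exp.eval, h2, h3]
  · exact ⟨h.var1, h.var2, h3, h.output, h.arr0, h.arr1, by simp, by simp⟩
  · obtain ⟨h1, h2, h3, h4, h5, h6, h7, h8⟩ := hs
    exact ⟨h1, h2, rfl, h4, h7, h8⟩

/-- The machine has no parity test, so the first loop handles both ends of an edge in one pass and
advances by two; the second loop covers the padding agents. -/
theorem runs_writeLists {q n : ℕ} {o : ℕ → ℕ} {A : ℕ → ℕ → ℕ} {out : List ℕ} {s : State}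
    (es ps : List Exp) (enc : ℕ → List ℕ) (h : Linked q n o A out s) (h3 : s.var 3 = 0)
    (hn : q + q ≤ n)
    (hes : ∀ k < q, ∀ s : State, s.arr = A → s.var 3 = k + k →
      es.map (Exp.eval s) = enc (k + k) ++ enc (k + k + 1))
    (hps : ∀ a, q + q ≤ a → ∀ s : State, s.arr = A → s.var 3 = a → ps.map (Exp.eval s) = enc a) :
    Runs (writeLists es ps) s
      (q * ((writeAll es).size + 7) + (n - (q + q)) * ((writeAll ps).size + 7) + 6)
      (Linked q n o A (out ++ (List.range n).flatMap enc)) := by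
  refine Runs.mono (Runs.seq (runs_while (N := q) (fun k s =>
    Linked q n o A (out ++ (List.range (k + k)).flatMap enc) s ∧ s.var 3 = k + k) ?_ ?_ ?_)
    fun s hs => runs_while (N := n - (q + q)) (fun k s =>
    Linked q n o A (out ++ (List.range (q + q + k)).flatMap enc) s ∧ s.var 3 = q + q + k)
      ?_ ?_ ?_) ?_ ?_
  · rintro k hk s ⟨hs, h3⟩
    refine ⟨by simp [Exp.eval, h3, hs.var1]; omega, wp_writeAll ?_⟩
    refine ⟨⟨by simp [hs.var1], by simp [hs.var2], hs.arr, ?_, hs.prev, hs.next⟩,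
      by simp [Exp.eval, h3]; omega⟩
    simp only [hs.output, hes k hk s hs.arr h3, show k + 1 + (k + 1) = k + k + 1 + 1 by omega,
      List.range_succ]
    simp
  · rintro s ⟨hs, h3⟩
    simp [Exp.eval, h3, hs.var1]
  · exact ⟨by simpa using h, h3⟩
  · rintro k hk s ⟨hs, h3⟩
    refine ⟨by simp [Exp.eval, h3, hs.var2]; omega, wp_writeAll ?_⟩
    refine ⟨⟨by simp [hs.var1], by simp [hs.var2], hs.arr, ?_, hs.prev, hs.next⟩,
      by simp [Exp.eval, h3]; omega⟩
    simp only [hs.output, hps _ (by omega) s hs.arr h3, ← Nat.add_assoc, List.range_succ]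
    simp
  · rintro s ⟨hs, h3⟩
    simp [Exp.eval, h3, hs.var2, hn]
  · simpa using hs
  · simp only [Exp.cost, Prog.size]
    apply le_of_eq
    ring
  · rintro s ⟨hs, -⟩
    rwa [show q + q + (n - (q + q)) = n by omega] at hs

/-- The encoded list of the man `a`. -/
def manCode (q : ℕ) (next : ℕ → ℕ) (a : ℕ) : List ℕ :=
  if a < q + q ∧ a % 2 = 1 then [3, a, a - 1, next a] else [2, a, next a]

/-- The encoded list of the woman `a`. -/
def womanCode (q : ℕ) (prev : ℕ → ℕ) (a : ℕ) : List ℕ :=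
  if a < q + q ∧ a % 2 = 0 then [3, prev a, a + 1, a] else [2, prev a, a]

theorem runs_writeMen {q n : ℕ} {o : ℕ → ℕ} {A : ℕ → ℕ → ℕ} {out : List ℕ} {s : State}
    (h : Linked q n o A out s) (h3 : s.var 3 = 0) (hn : q + q ≤ n) :
    Runs writeMen s (q * 40 + n * 40 + 6)
      (Linked q n o A (out ++ (List.range n).flatMap (manCode q (A 4)))) := by
  refine (runs_writeLists _ _ (manCode q (A 4)) h h3 hn ?_ ?_).mono ?_ fun _ h => h
  · intro k hk s hA h3
    have h1 : ¬ (k + k < q + q ∧ (k + k) % 2 = 1) := by omega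
    have h2 : k + k + 1 < q + q ∧ (k + k + 1) % 2 = 1 := by omega
    simp [manCode, Exp.eval, hA, h3, h1, h2]
  · intro a ha s hA h3
    have h1 : ¬ (a < q + q ∧ a % 2 = 1) := by omega
    simp [manCode, Exp.eval, hA, h3, h1]
  · simp only [writeAll, Prog.size, Exp.cost]
    omega

theorem runs_writeWomen {q n : ℕ} {o : ℕ → ℕ} {A : ℕ → ℕ → ℕ} {out : List ℕ} {s : State}
    (h : Linked q n o A out s) (h3 : s.var 3 = 0) (hn : q + q ≤ n) :
    Runs writeWomen s (q * 40 + n * 40 + 6)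
      (Linked q n o A (out ++ (List.range n).flatMap (womanCode q (A 3)))) := by
  refine (runs_writeLists _ _ (womanCode q (A 3)) h h3 hn ?_ ?_).mono ?_ fun _ h => h
  · intro k hk s hA h3
    have h1 : k + k < q + q ∧ (k + k) % 2 = 0 := by omega
    have h2 : ¬ (k + k + 1 < q + q ∧ (k + k + 1) % 2 = 0) := by omega
    simp [womanCode, Exp.eval, hA, h3, h1, h2]
  · intro a ha s hA h3
    have h1 : ¬ (a < q + q ∧ a % 2 = 0) := by omega
    simp [womanCode, Exp.eval, hA, h3, h1]
  · simp only [writeAll, Prog.size, Exp.cost]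
    omega

theorem length_padded_le (p c : ℕ) (F : List ℕ) : (padded p c F).length ≤ F.length + p := by
  have := List.length_filter_le (fun v => decide (F.count v < c)) (List.range p)
  simp only [padded, List.length_append, List.length_range] at this ⊢
  omega

theorem length_le_padded (p c : ℕ) (F : List ℕ) : F.length ≤ (padded p c F).length := by
  simp [padded]

theorem length_owners_le (p : ℕ) (F : List ℕ) : (owners p F).length ≤ F.length + p + p :=
  (length_padded_le _ _ _).trans (Nat.add_le_add_right (length_padded_le _ _ _) _)

theorem length_le_owners (p : ℕ) (F : List ℕ) : F.length ≤ (owners p F).length :=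
  (length_le_padded _ _ _).trans (length_le_padded _ _ _)

theorem wp_readSize {p q : ℕ} {F : List ℕ} :
    wp (.seq (.read 0) (.seq (.read 1) (.assign 1 (.add (.var 1) (.var 1)))))
      (init (p :: q :: F)) (Built p q [] F) := by
  refine ⟨_, _, rfl, _, _, rfl, ?_⟩
  constructor <;> simp [init, Exp.eval, lastOcc]

theorem computesWithin_prog_zero : ComputesWithin prog [0, 0] [1, 1, 0, 1, 0] 1000 := by
  obtain ⟨t, s, h1, h2, h3⟩ : Runs prog (init [0, 0]) 1000 fun s => s.output = [1, 1, 0, 1, 0] := by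
    refine ((runs_of_wp wp_readSize).seq fun s hs => Runs.ifLt_pos (by simp [Exp.eval, hs.var0])
      (runs_of_wp (wp_writeAll ?_))).mono (by simp [Prog.size, Exp.cost, writeAll]) fun _ h => h
    simp [hs.output, Exp.eval]
  exact ⟨t, s, h1, h2, h3⟩

theorem computesWithin_prog {p q : ℕ} {F : List ℕ} (hp : 0 < p) (hF : F.length = q + q)
    (hinj : ∀ a < (owners p F).length, ∀ b < (owners p F).length,
      prevOcc (fun a => (owners p F).getD a 0) (owners p F).length a =
        prevOcc (fun a => (owners p F).getD a 0) (owners p F).length b → a = b) :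
    ∃ next prev : ℕ → ℕ,
      (∀ a < (owners p F).length,
        prev a = prevOcc (fun a => (owners p F).getD a 0) (owners p F).length a) ∧
      (∀ a < (owners p F).length, next (prev a) = a) ∧
      ComputesWithin prog (p :: q :: F) ((owners p F).length ::
        ((List.range (owners p F).length).flatMap (manCode q next) ++
        (List.range (owners p F).length).flatMap (womanCode q prev))) (1000 * (p + q + 1)) := by
  set n := (owners p F).length with hn
  have hn1 : n ≤ q + q + p + p := hF ▸ length_owners_le p F
  have hn2 : q + q ≤ n := hF ▸ length_le_owners p F
  set o : ℕ → ℕ := fun a => (owners p F).getD a 0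
  have key : Runs prog (init (p :: q :: F)) (1000 * (p + q + 1)) (fun s => ∃ A,
      Linked q n o A ((n :: (List.range n).flatMap
        (manCode q (A 4))) ++ (List.range n).flatMap (womanCode q (A 3))) s) := by
    have hreset : ∀ {A : ℕ → ℕ → ℕ} {out : List ℕ} {s : State}, Linked q n o A out s →
        wp reset s fun s => Linked q n o A out s ∧ s.var 3 = 0 := fun h =>
      ⟨⟨by simp [h.var1], by simp [h.var2], h.arr, h.output, h.prev, h.next⟩, by simp [Exp.eval]⟩
    refine Runs.mono (Q := fun s => ∃ A, Linked q n o A ((n :: (List.range n).flatMap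
        (manCode q (A 4))) ++ (List.range n).flatMap (womanCode q (A 3))) s)
      ((runs_of_wp wp_readSize).seq fun s hs => Runs.ifLt_neg (by simp [Exp.eval, hs.var0, hp.ne']) <|
      (runs_readEdges hF hs).seq fun s hs =>
      (runs_of_wp (wp_reset hs)).seq fun s hs => (runs_pad 1 hs.1 hs.2).seq fun s hs =>
      (runs_of_wp (wp_reset hs)).seq fun s hs => (runs_pad 2 hs.1 hs.2).seq fun s hs =>
      (runs_of_wp (wp_reset hs)).seq fun s hs => (runs_link hs.1 hs.2 hinj).seq fun s hs =>
      Runs.seq (Q := Linked q n o s.arr [n]) (runs_of_wp ?_) fun s' hs =>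
      (runs_of_wp (hreset hs)).seq fun s hs => (runs_writeMen hs.1 hs.2 hn2).seq fun s hs =>
      (runs_of_wp (hreset hs)).seq fun s hs =>
      (runs_writeWomen hs.1 hs.2 hn2).mono le_rfl fun _ h => ⟨_, h⟩) ?_ fun _ h => h
    · exact ⟨hs.var1, hs.var2, rfl, by simp [hs.output, Exp.eval, hs.var2]; rfl, hs.prev, hs.next⟩
    -- All bounds are linear in `p`, `q` and `n`, and `n ≤ 2q + 2p`; the constant 1000 is generous.
    · have h1 : (padded p 2 (padded p 1 F)).length = n := rfl
      simp only [Prog.size, Exp.cost, reset, h1]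
      omega
  obtain ⟨t, s, h1, h2, A, h3⟩ := key
  exact ⟨A 4, A 3, h3.prev, fun a ha => by rw [h3.prev a ha, h3.next a ha],
    t, s, h1, h2, by rw [h3.output, List.cons_append]⟩

end RAM

/-! ## Lists -/

/-- If nothing precedes `a`, the cyclic predecessor wraps round to the last element of `l`. The
default `d` is never reached, as `l` contains `a`. -/
theorem prev_append_cons {α : Type*} [DecidableEq α] {l l₁ l₂ : List α} {a : α} (hl : l.Nodup)
    (h : l = l₁ ++ a :: l₂) (ha : a ∈ l) (d : α) :
    l.prev a ha = l₁.getLastD (l.getLastD d) := by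
  subst h
  rcases List.eq_nil_or_concat' l₁ with rfl | ⟨l₁, b, rfl⟩
  · refine (List.prev_getLast_cons' l₂ a a ha rfl).trans ?_
    simp [List.getLastD_eq_getLast?, List.getLast?_eq_some_getLast]
  · have := List.prev_getElem _ hl (l₁ ++ [b]).length (by simp)
    have e : ((l₁ ++ [b]).length + ((l₁ ++ [b] ++ a :: l₂).length - 1)) %
        (l₁ ++ [b] ++ a :: l₂).length = l₁.length := by
      simp only [List.length_append, List.length_cons, List.length_nil]
      rw [show l₁.length + (0 + 1) + (l₁.length + (0 + 1) + (l₂.length + 1) - 1) =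
        l₁.length + (l₁.length + (0 + 1) + (l₂.length + 1)) by omega, Nat.add_mod_right,
        Nat.mod_eq_of_lt (by omega)]
    simp only [e] at this
    simpa [List.getElem_append] using this

theorem filterMap_eq_toList {α β : Type*} {f : α → Option β} {l : List α} (hl : l.Nodup) {a : α}
    (ha : a ∈ l) (h : ∀ b ∈ l, b ≠ a → f b = none) : l.filterMap f = (f a).toList := by
  induction l with
  | nil => simp at ha
  | cons x l ih =>
    obtain ⟨hx, hl⟩ := List.nodup_cons.1 hl
    rcases List.mem_cons.1 ha with rfl | ha
    · have : l.filterMap f = [] := List.filterMap_eq_nil_iff.2 fun b hb =>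
        h b (List.mem_cons_of_mem _ hb) fun e => hx (e ▸ hb)
      cases hf : f a <;> simp [this, hf]
    · rw [List.filterMap_cons, h x List.mem_cons_self fun e => hx (e ▸ ha)]
      exact ih hl ha fun b hb => h b (List.mem_cons_of_mem _ hb)

theorem count_eq_length_filter_range (l : List ℕ) (v : ℕ) :
    l.count v = ((List.range l.length).filter fun a => l.getD a 0 = v).length := by
  induction l using List.reverseRecOn with
  | nil => rfl
  | append_singleton l x ih =>
    rw [List.count_append, ih, List.length_append, List.length_singleton, List.range_succ,
      List.filter_append, List.length_append]
    congr 1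
    · congr 1
      refine List.filter_congr fun a ha => ?_
      rw [List.mem_range] at ha
      rw [decide_eq_decide, List.getD_append _ _ _ _ ha]
    · by_cases h : x = v <;> simp [List.getD, h]

/-! ### The computed links as neighbours in a cyclic list, and the padded list of vertices -/

namespace RAM

theorem lastOcc_eq (o : ℕ → ℕ) (d v k : ℕ) :
    lastOcc o d v k = ((List.range k).filter fun a => o a = v).getLastD d := by
  induction k with
  | zero => rfl
  | succ k ih =>
    rw [lastOcc, List.range_succ, List.filter_append, ih]
    split_ifs with h <;> simp [h]

/-- The nested `lastOcc` in `prevOcc` mirrors the two cases of a cyclic predecessor: the last agent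
before `a` at the same vertex, or by default the last one overall. -/
theorem prevOcc_eq {o : ℕ → ℕ} {n a : ℕ} (ha : a < n)
    (hmem : a ∈ (List.range n).filter fun b => o b = o a) :
    prevOcc o n a = ((List.range n).filter fun b => o b = o a).prev a hmem := by
  obtain ⟨r, hr⟩ : ∃ r, List.range n = List.range a ++ a :: r := by
    obtain ⟨m, rfl⟩ : ∃ m, n = a + 1 + m := ⟨n - (a + 1), by omega⟩
    exact ⟨_, by rw [List.range_add, List.range_succ, List.append_assoc]; rfl⟩
  rw [prev_append_cons (List.nodup_range.filter _) (l₁ := (List.range a).filter fun b => o b = o a)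
    (l₂ := r.filter fun b => o b = o a) _ hmem 0, prevOcc, lastOcc_eq, lastOcc_eq]
  rw [hr]
  simp

theorem count_padded {p c v : ℕ} (F : List ℕ) (hv : v < p) :
    (padded p c F).count v = F.count v + if F.count v < c then 1 else 0 := by
  rw [padded, List.count_append, List.Nodup.count (List.nodup_range.filter _)]
  simp [hv]

theorem count_owners {p v : ℕ} (F : List ℕ) (hv : v < p) :
    (owners p F).count v = max 2 (F.count v) := by
  rw [owners, count_padded _ hv, count_padded _ hv]
  split_ifs <;> omega

theorem lt_of_mem_padded {p c v : ℕ} {F : List ℕ} (hF : ∀ v ∈ F, v < p)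
    (h : v ∈ padded p c F) : v < p := by
  rcases List.mem_append.1 h with h | h
  · exact hF v h
  · simpa using (List.mem_filter.1 h).1

theorem lt_of_mem_owners {p v : ℕ} {F : List ℕ} (hF : ∀ v ∈ F, v < p)
    (h : v ∈ owners p F) : v < p :=
  lt_of_mem_padded (fun _ => lt_of_mem_padded hF) h

theorem getD_padded_of_lt {p c a : ℕ} {F : List ℕ} (ha : a < F.length) :
    (padded p c F).getD a 0 = F.getD a 0 := by
  simp [padded, List.getD, List.getElem?_append_left ha]

theorem getD_owners_of_lt {p a : ℕ} {F : List ℕ} (ha : a < F.length) :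
    (owners p F).getD a 0 = F.getD a 0 := by
  rw [owners, getD_padded_of_lt (ha.trans_le (length_le_padded _ _ _)), getD_padded_of_lt ha]

theorem getD_padded_injective {p c a b : ℕ} {F : List ℕ} (ha : F.length ≤ a) (hb : F.length ≤ b)
    (ha' : a < (padded p c F).length) (hb' : b < (padded p c F).length)
    (h : (padded p c F).getD a 0 = (padded p c F).getD b 0) : a = b := by
  have hlen : (padded p c F).length =
      F.length + ((List.range p).filter fun v => F.count v < c).length := List.length_append
  have key : ∀ a, F.length ≤ a → ∀ _ : a < (padded p c F).length, (padded p c F).getD a 0 =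
      ((List.range p).filter fun v => F.count v < c)[a - F.length]'(by omega) := by
    intro a ha ha'
    rw [List.getD_eq_getElem _ _ ha']
    simp [padded, List.getElem_append_right ha]
  rw [key a ha ha', key b hb hb', (List.nodup_range.filter _).getElem_inj_iff] at h
  omega

end RAM

open RAM

/-! ### The numbered agents, their vertices and their colours -/

section Concrete

variable {X : Type u} {p : ℕ}

/-- The numbers of the ends of the edges. -/
def edgeEnds (label : X ≃ Fin p) (E : List (X × X)) : List ℕ :=
  E.flatMap fun e => [(label e.1).val, (label e.2).val]

theorem length_edgeEnds (label : X ≃ Fin p) (E : List (X × X)) :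
    (edgeEnds label E).length = E.length + E.length := by
  induction E with
  | nil => rfl
  | cons e E ih =>
    simp only [edgeEnds, List.flatMap_cons, List.length_append, List.length_cons,
      List.length_nil] at ih ⊢
    omega

theorem getD_edgeEnds (label : X ≃ Fin p) (E : List (X × X)) (i : ℕ) (hi : i < E.length) :
    (edgeEnds label E).getD (i + i) 0 = (label E[i].1).val ∧
      (edgeEnds label E).getD (i + i + 1) 0 = (label E[i].2).val := by
  induction E generalizing i with
  | nil => simp at hi
  | cons e E ih =>
    cases i with
    | zero => simp [edgeEnds]
    | succ i =>
      have := ih i (by simpa using hi)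
      rw [show i + 1 + (i + 1) = i + i + 1 + 1 by omega]
      simpa [edgeEnds] using this

theorem lt_of_mem_edgeEnds (label : X ≃ Fin p) (E : List (X × X)) :
    ∀ v ∈ edgeEnds label E, v < p := by
  intro v hv
  obtain ⟨e, -, h⟩ := List.mem_flatMap.1 hv
  simp only [List.mem_cons, List.not_mem_nil, or_false] at h
  rcases h with rfl | rfl <;> exact Fin.is_lt _

/-- The numbers of the vertices of the agents. -/
abbrev agentOwners (label : X ≃ Fin p) (E : List (X × X)) : List ℕ := owners p (edgeEnds label E)

/-- The number of men, and also of women. -/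
abbrev numAgents (label : X ≃ Fin p) (E : List (X × X)) : ℕ := (agentOwners label E).length

theorem two_mul_length_le (label : X ≃ Fin p) (E : List (X × X)) :
    E.length + E.length ≤ numAgents label E :=
  length_edgeEnds label E ▸ length_le_owners _ _

/-- The vertex of an agent. -/
def ownerOf (label : X ≃ Fin p) (E : List (X × X)) (a : Fin (numAgents label E)) : X :=
  label.symm ⟨(agentOwners label E).getD a 0, by
    rw [List.getD_eq_getElem _ _ a.2]
    exact lt_of_mem_owners (lt_of_mem_edgeEnds label E) (List.getElem_mem _)⟩

theorem ownerOf_eq_iff {label : X ≃ Fin p} {E : List (X × X)} {a : Fin (numAgents label E)}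
    {v : X} : ownerOf label E a = v ↔ (agentOwners label E).getD a 0 = (label v).val := by
  rw [ownerOf, Equiv.symm_apply_eq, Fin.ext_iff]

theorem ownerOf_two_mul {label : X ≃ Fin p} {E : List (X × X)} {a : Fin (numAgents label E)}
    {i : ℕ} (hi : i < E.length) (ha : a.val = i + i) : ownerOf label E a = E[i].1 := by
  rw [ownerOf_eq_iff, ha, getD_owners_of_lt (by rw [length_edgeEnds]; omega),
    (getD_edgeEnds label E i hi).1]

theorem ownerOf_two_mul_add_one {label : X ≃ Fin p} {E : List (X × X)}
    {a : Fin (numAgents label E)} {i : ℕ} (hi : i < E.length) (ha : a.val = i + i + 1) :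
    ownerOf label E a = E[i].2 := by
  rw [ownerOf_eq_iff, ha, getD_owners_of_lt (by rw [length_edgeEnds]; omega),
    (getD_edgeEnds label E i hi).2]

/-- The colour of an agent. -/
def agentColor (label : X ≃ Fin p) (E : List (X × X)) (a : Fin (numAgents label E)) : ℕ+ :=
  ⟨if a.val < E.length + E.length then a.val / 2 + 3
    else if a.val < (padded p 1 (edgeEnds label E)).length then 1 else 2, by split_ifs <;> omega⟩

theorem fst_ne_snd_of_listsHasseEdges [PartialOrder X] {E : List (X × X)}
    (hE : ListsHasseEdges E) {i : ℕ} (hi : i < E.length) :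
    E[i].1 ≠ E[i].2 := ((hE.2 _ _).1 (List.getElem_mem hi)).ne

/-- Two different agents with the same edge colour are the two ends of one edge, hence at different
vertices. Two with the same padding colour come from the same pass, which visits each vertex once.
-/
theorem eq_of_agentColor_eq [PartialOrder X] {label : X ≃ Fin p} {E : List (X × X)}
    (hE : ListsHasseEdges E) {a b : Fin (numAgents label E)}
    (ho : ownerOf label E a = ownerOf label E b) (h : agentColor label E a = agentColor label E b) :
    a = b := by
  have ho' : (agentOwners label E).getD a 0 = (agentOwners label E).getD b 0 := by
    rw [ownerOf_eq_iff.1 ho, ownerOf_eq_iff.1 rfl]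
  replace h := congrArg PNat.val h
  simp only [agentColor, PNat.mk_coe] at h
  have hlen := length_edgeEnds label E
  have hle := length_le_padded p 1 (edgeEnds label E)
  apply Fin.ext
  split_ifs at h
  · by_contra hne
    have hi : a.val / 2 < E.length := by omega
    rcases Nat.mod_two_eq_zero_or_one a.val with h0 | h0
    · rw [ownerOf_two_mul hi (by omega), ownerOf_two_mul_add_one hi (by omega)] at ho
      exact fst_ne_snd_of_listsHasseEdges hE hi ho
    · rw [ownerOf_two_mul_add_one hi (by omega), ownerOf_two_mul hi (by omega)] at ho
      exact fst_ne_snd_of_listsHasseEdges hE hi ho.symm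
  all_goals try omega
  · rw [agentOwners, owners, getD_padded_of_lt (a := a) (by omega),
      getD_padded_of_lt (a := b) (by omega)] at ho'
    exact getD_padded_injective (by omega) (by omega) (by omega) (by omega) ho'
  · exact getD_padded_injective (by omega) (by omega) a.2 b.2 ho'

theorem agentColor_val {label : X ≃ Fin p} {E : List (X × X)}
    (a : Fin (numAgents label E)) : (agentColor label E a : ℕ) =
    if a.val < E.length + E.length then a.val / 2 + 3
    else if a.val < (padded p 1 (edgeEnds label E)).length then 1 else 2 := rfl

theorem agent_ext {π : X → List ℕ+} {x y : Agent π} (h : x.1 = y.1) (h' : x.2.1 = y.2.1) :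
    x = y := by
  obtain ⟨v, c, hc⟩ := x
  obtain ⟨v', c', hc'⟩ := y
  dsimp only at h h'
  subst h h'
  rfl

variable [DecidableEq X]

/-- The agents at the vertex `v`. -/
def agentsAt (label : X ≃ Fin p) (E : List (X × X)) (v : X) : List (Fin (numAgents label E)) :=
  (List.finRange _).filter fun a => ownerOf label E a = v

theorem mem_agentsAt {label : X ≃ Fin p} {E : List (X × X)} {v : X}
    {a : Fin (numAgents label E)} : a ∈ agentsAt label E v ↔ ownerOf label E a = v := by
  simp [agentsAt]

theorem nodup_agentsAt (label : X ≃ Fin p) (E : List (X × X)) (v : X) :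
    (agentsAt label E v).Nodup := (List.nodup_finRange _).filter _

theorem map_val_agentsAt (label : X ≃ Fin p) (E : List (X × X)) (v : X) :
    (agentsAt label E v).map Fin.val = (List.range (numAgents label E)).filter fun a =>
      (agentOwners label E).getD a 0 = (label v).val := by
  rw [← List.map_coe_finRange_eq_range, List.filter_map, agentsAt]
  congr 1
  refine List.filter_congr fun a _ => ?_
  simp [ownerOf_eq_iff]

theorem length_agentsAt (label : X ≃ Fin p) (E : List (X × X)) (v : X) :
    (agentsAt label E v).length = max 2 ((edgeEnds label E).count (label v).val) := by
  rw [← count_owners _ (label v).2, count_eq_length_filter_range, ← map_val_agentsAt,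
    List.length_map]

/-- The cyclic ordering of the colours at a vertex. -/
def colorsAt (label : X ≃ Fin p) (E : List (X × X)) (v : X) : List ℕ+ :=
  (agentsAt label E v).map (agentColor label E)

/-- The agent of the generic construction with the same vertex and colour. -/
def toAgent {label : X ≃ Fin p} {E : List (X × X)} (a : Fin (numAgents label E)) :
    Agent (colorsAt label E) :=
  ⟨ownerOf label E a, agentColor label E a, List.mem_map_of_mem (mem_agentsAt.2 rfl)⟩

theorem agent?_eq {label : X ≃ Fin p} {E : List (X × X)} {a : Fin (numAgents label E)} {v : X}
    {c : ℕ+} (h : ownerOf label E a = v)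
    (h' : agentColor label E a = c) : agent? (colorsAt label E) v c = some (toAgent a) := by
  subst h h'
  exact dif_pos (List.mem_map_of_mem (mem_agentsAt.2 rfl))

variable [PartialOrder X]

/-- The agents of the instance, linked along the edges in `E`: the agents `2 * i` and `2 * i + 1`
are the ends of the edge with the number `i`. -/
def edgeClasses (label : X ≃ Fin p) (E : List (X × X)) (hE : ListsHasseEdges E) :
    CyclicClasses X (Fin (numAgents label E)) where
  own := ownerOf label E
  cyc := agentsAt label E
  cyc_nodup := nodup_agentsAt label E
  mem_cyc := mem_agentsAt
  two_le v := by
    rw [length_agentsAt]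
    exact le_max_left _ _
  low a := if a.val < E.length + E.length ∧ a.val % 2 = 1 then
    some ⟨a.val - 1, (Nat.sub_le _ _).trans_lt a.2⟩ else none
  high a := if h : a.val < E.length + E.length ∧ a.val % 2 = 0 then
    some ⟨a.val + 1, by have := two_mul_length_le label E; omega⟩ else none
  high_eq a b := by
    simp only [Option.dite_none_right_eq_some, Option.ite_none_right_eq_some, Option.some.injEq,
      Fin.ext_iff]
    constructor
    · rintro ⟨h1, h2⟩
      omega
    · rintro ⟨h1, h2⟩
      exact ⟨by omega, by omega⟩
  covBy a b h := by
    simp only [Option.ite_none_right_eq_some, Option.some.injEq] at h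
    obtain ⟨⟨h1, h2⟩, rfl⟩ := h
    have hi : a.val / 2 < E.length := by omega
    rw [ownerOf_two_mul_add_one (a := a) hi (by omega),
      ownerOf_two_mul hi (show a.val - 1 = _ by omega)]
    exact (hE.2 _ _).1 (List.getElem_mem hi)
  exists_low u v h := by
    obtain ⟨i, hi, e⟩ := List.getElem_of_mem ((hE.2 u v).2 h)
    have := two_mul_length_le label E
    refine ⟨⟨i + i + 1, by omega⟩, ⟨i + i, by omega⟩, ?_, ?_, ?_⟩
    · rw [if_pos (by dsimp only; omega)]
      rfl
    · rw [ownerOf_two_mul hi rfl, e]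
    · rw [ownerOf_two_mul_add_one hi rfl, e]

/-! ### The colouring -/

/-- All edges have different colours, and the colours `1` and `2` are not used. -/
def edgeColor (E : List (X × X)) (u v : X) : ℕ+ := ⟨E.idxOf (u, v) + 3, by omega⟩

variable {label : X ≃ Fin p} {E : List (X × X)}

theorem isSuperColoring_edgeColor (hE : ListsHasseEdges E) : IsSuperColoring (edgeColor E) := by
  have key : ∀ u v u' v', u ⋖ v → edgeColor E u v = edgeColor E u' v' → (u, v) = (u', v') := by
    intro u v u' v' h e
    have : E.idxOf (u, v) = E.idxOf (u', v') := by
      have := congrArg PNat.val e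
      simpa [edgeColor] using this
    exact (List.idxOf_inj ((hE.2 u v).2 h)).1 this
  constructor
  · intro u u' v h _ hne e
    exact hne (Prod.ext_iff.1 (key _ _ _ _ h e)).1
  · intro u v v' h _ hne e
    exact hne (Prod.ext_iff.1 (key _ _ _ _ h e)).2

theorem edgeColor_eq_agentColor_iff (hE : ListsHasseEdges E) {a : Fin (numAgents label E)} {u v : X}
    (h : (u, v) ∈ E) : edgeColor E u v = agentColor label E a ↔
      ∃ hi : a.val / 2 < E.length, E[a.val / 2] = (u, v) := by
  rw [← PNat.coe_inj, agentColor_val, edgeColor, PNat.mk_coe]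
  have hlt := List.idxOf_lt_length_of_mem h
  constructor
  · intro e
    have : E.idxOf (u, v) = a.val / 2 := by
      split_ifs at e <;> omega
    simp only [← this]
    exact ⟨hlt, List.getElem_idxOf hlt⟩
  · rintro ⟨hi, e⟩
    rw [if_pos (by omega), ← e, hE.1.idxOf_getElem]

theorem nodup_colorsAt (hE : ListsHasseEdges E) (v : X) : (colorsAt label E v).Nodup := by
  refine List.Nodup.map_on ?_ (nodup_agentsAt label E v)
  intro a ha b hb h
  exact eq_of_agentColor_eq hE ((mem_agentsAt.1 ha).trans (mem_agentsAt.1 hb).symm) h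

theorem mem_incidentColors (hE : ListsHasseEdges E) {v : X} {c : ℕ+} :
    c ∈ incidentColors (edgeColor E) v ↔ ∃ a : Fin (numAgents label E),
      a.val < E.length + E.length ∧ ownerOf label E a = v ∧ agentColor label E a = c := by
  have hle := two_mul_length_le label E
  constructor
  · rintro (⟨u, h, rfl⟩ | ⟨u, h, rfl⟩)
    · have hm := (hE.2 _ _).2 h
      obtain ⟨i, hi, e⟩ := List.getElem_of_mem hm
      refine ⟨⟨i + i + 1, by omega⟩, by dsimp only; omega, ?_, Eq.symm ?_⟩
      · rw [ownerOf_two_mul_add_one hi rfl, e]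
      · have h2 : (i + i + 1) / 2 = i := by omega
        exact (edgeColor_eq_agentColor_iff hE hm).2 ⟨by simpa [h2], by simpa [h2]⟩
    · have hm := (hE.2 _ _).2 h
      obtain ⟨i, hi, e⟩ := List.getElem_of_mem hm
      refine ⟨⟨i + i, by omega⟩, by dsimp only; omega, ?_, Eq.symm ?_⟩
      · rw [ownerOf_two_mul hi rfl, e]
      · have h2 : (i + i) / 2 = i := by omega
        exact (edgeColor_eq_agentColor_iff hE hm).2 ⟨by simpa [h2], by simpa [h2]⟩
  · rintro ⟨a, ha, rfl, rfl⟩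
    have hi : a.val / 2 < E.length := by omega
    have hm : E[a.val / 2] ∈ E := List.getElem_mem hi
    have hc := (edgeColor_eq_agentColor_iff (a := a) hE hm).2 ⟨hi, rfl⟩
    have hcov := (hE.2 _ _).1 hm
    rcases Nat.mod_two_eq_zero_or_one a.val with h0 | h0
    · rw [ownerOf_two_mul hi (by omega)]
      exact .inr ⟨_, hcov, hc⟩
    · rw [ownerOf_two_mul_add_one hi (by omega)]
      exact .inl ⟨_, hcov, hc⟩

/-- As no colour repeats at a vertex, incident colours can be counted as agents that are ends of
edges, that is, as occurrences of `v` in `edgeEnds`. -/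
theorem ncard_incidentColors (hE : ListsHasseEdges E) (v : X) :
    (incidentColors (edgeColor E) v).ncard = (edgeEnds label E).count (label v).val := by
  have hle := two_mul_length_le label E
  have h1 : incidentColors (edgeColor E) v = agentColor label E ''
      {a | a.val < E.length + E.length ∧ ownerOf label E a = v} := by
    ext c
    rw [mem_incidentColors (label := label) hE]
    simp [and_assoc]
  have h2 : Fin.val '' {a : Fin (numAgents label E) |
      a.val < E.length + E.length ∧ ownerOf label E a = v} =
      ((List.range (edgeEnds label E).length).filter
        fun a => (edgeEnds label E).getD a 0 = (label v).val).toFinset := by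
    ext a
    simp only [Set.mem_image, Set.mem_ofPred_eq, ownerOf_eq_iff, List.coe_toFinset,
      List.mem_filter, List.mem_range, decide_eq_true_eq, length_edgeEnds]
    constructor
    · rintro ⟨a, ⟨ha, h⟩, rfl⟩
      rw [getD_owners_of_lt (by rwa [length_edgeEnds])] at h
      exact ⟨ha, h⟩
    · rintro ⟨ha, h⟩
      refine ⟨⟨a, by omega⟩, ⟨ha, ?_⟩, rfl⟩
      rwa [getD_owners_of_lt (by rwa [length_edgeEnds])]
  rw [h1, Set.InjOn.ncard_image, ← Set.ncard_image_of_injective _ Fin.val_injective, h2,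
    Set.ncard_coe_finset, List.toFinset_card_of_nodup (List.nodup_range.filter _),
    ← count_eq_length_filter_range]
  rintro a ⟨-, ha⟩ b ⟨-, hb⟩ h
  exact eq_of_agentColor_eq hE (ha.trans hb.symm) h

theorem isColorOrdering_colorsAt (hE : ListsHasseEdges E) :
    IsColorOrdering (edgeColor E) (colorsAt label E) := by
  refine fun v => ⟨nodup_colorsAt hE v, ?_, ?_, ?_⟩
  · rw [ncard_incidentColors (label := label) hE, colorsAt, List.length_map, length_agentsAt]
  · intro c hc
    obtain ⟨a, -, ha, rfl⟩ := (mem_incidentColors (label := label) hE).1 hc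
    exact List.mem_map_of_mem (mem_agentsAt.2 ha)
  · intro c hc
    obtain ⟨a, ha, rfl⟩ := List.mem_map.1 hc
    by_cases h : a.val < E.length + E.length
    · exact .inl ((mem_incidentColors (label := label) hE).2 ⟨a, h, mem_agentsAt.1 ha, rfl⟩)
    · right
      rw [← PNat.coe_inj, ← PNat.coe_inj, agentColor_val, if_neg h]
      split_ifs <;> simp

/-! ### The isomorphism with the generic construction -/

theorem toAgent_bijective (hE : ListsHasseEdges E) :
    Function.Bijective (toAgent (label := label) (E := E)) := by
  constructor
  · intro a b h
    exact eq_of_agentColor_eq hE (congrArg Sigma.fst h)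
      (congrArg (fun x : Agent (colorsAt label E) => x.2.1) h)
  · rintro ⟨v, c, hc⟩
    obtain ⟨a, ha, rfl⟩ := List.mem_map.1 hc
    exact ⟨a, agent_ext (mem_agentsAt.1 ha) rfl⟩

theorem nextAgent_toAgent (hE : ListsHasseEdges E) (a : Fin (numAgents label E)) :
    nextAgent (toAgent a) = toAgent ((edgeClasses label E hE).nxt a) :=
  agent_ext ((edgeClasses label E hE).own_nxt a).symm
    (next_map (nodup_colorsAt hE _) (mem_agentsAt.2 rfl))

theorem prevAgent_toAgent (hE : ListsHasseEdges E) (a : Fin (numAgents label E)) :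
    prevAgent (toAgent a) = toAgent ((edgeClasses label E hE).prv a) :=
  agent_ext ((edgeClasses label E hE).own_prv a).symm
    (prev_map (nodup_colorsAt hE _) (mem_agentsAt.2 rfl))

/-- Only the edge number `a / 2` can have the colour of `a`, so the filtered list has at most one
entry. If `a` is the lower end of that edge, the edge does not enter the vertex of `a`, since its
ends differ. -/
theorem filterMap_lower (hE : ListsHasseEdges E) (a : Fin (numAgents label E)) :
    E.filterMap (fun e => if e.2 = (toAgent a).1 ∧ edgeColor E e.1 e.2 = (toAgent a).2.1
      then agent? (colorsAt label E) e.1 (toAgent a).2.1 else none) =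
    (((edgeClasses label E hE).low a).map toAgent).toList := by
  by_cases h : a.val < E.length + E.length ∧ a.val % 2 = 1
  · have hi : a.val / 2 < E.length := by omega
    have hm : E[a.val / 2] ∈ E := List.getElem_mem hi
    have hlow : (edgeClasses label E hE).low a =
      some ⟨a.val - 1, (Nat.sub_le _ _).trans_lt a.2⟩ := if_pos h
    rw [hlow, filterMap_eq_toList hE.1 hm, if_pos, agent?_eq (ownerOf_two_mul hi ?_)]
    · rfl
    · rw [← PNat.coe_inj]
      change agentColor label E _ = (agentColor label E a : ℕ)
      rw [agentColor_val, agentColor_val, if_pos h.1, if_pos (by dsimp only; omega)]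
      dsimp only
      omega
    · dsimp only
      omega
    · exact ⟨(ownerOf_two_mul_add_one hi (by omega)).symm,
        (edgeColor_eq_agentColor_iff hE hm).2 ⟨hi, rfl⟩⟩
    · intro e he hne
      refine if_neg fun hc => hne ?_
      obtain ⟨_, he'⟩ := (edgeColor_eq_agentColor_iff hE he).1 hc.2
      exact he'.symm
  · have hlow : (edgeClasses label E hE).low a = none := if_neg h
    rw [hlow, Option.map_none, Option.toList_none, List.filterMap_eq_nil_iff]
    intro e he
    refine if_neg fun hc => ?_
    obtain ⟨hi, he'⟩ := (edgeColor_eq_agentColor_iff hE he).1 hc.2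
    have ho : e.2 = E[a.val / 2].1 := hc.1.trans (ownerOf_two_mul hi (by omega))
    apply fst_ne_snd_of_listsHasseEdges hE hi
    rw [← ho, he']

theorem filterMap_upper (hE : ListsHasseEdges E) (a : Fin (numAgents label E)) :
    E.filterMap (fun e => if e.1 = (toAgent a).1 ∧ edgeColor E e.1 e.2 = (toAgent a).2.1
      then agent? (colorsAt label E) e.2 (toAgent a).2.1 else none) =
    (((edgeClasses label E hE).high a).map toAgent).toList := by
  by_cases h : a.val < E.length + E.length ∧ a.val % 2 = 0
  · have hi : a.val / 2 < E.length := by omega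
    have hm : E[a.val / 2] ∈ E := List.getElem_mem hi
    have hlt : a.val + 1 < numAgents label E := by
      have := two_mul_length_le label E
      omega
    have hhigh : (edgeClasses label E hE).high a = some ⟨a.val + 1, hlt⟩ := dif_pos h
    rw [hhigh, filterMap_eq_toList hE.1 hm, if_pos,
      agent?_eq (a := ⟨a.val + 1, hlt⟩) (ownerOf_two_mul_add_one hi ?_)]
    · rfl
    · rw [← PNat.coe_inj]
      change agentColor label E _ = (agentColor label E a : ℕ)
      rw [agentColor_val, agentColor_val, if_pos h.1, if_pos (by dsimp only; omega)]
      dsimp only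
      omega
    · dsimp only
      omega
    · exact ⟨(ownerOf_two_mul hi (by omega)).symm,
        (edgeColor_eq_agentColor_iff hE hm).2 ⟨hi, rfl⟩⟩
    · intro e he hne
      refine if_neg fun hc => hne ?_
      obtain ⟨_, he'⟩ := (edgeColor_eq_agentColor_iff hE he).1 hc.2
      exact he'.symm
  · have hhigh : (edgeClasses label E hE).high a = none := dif_neg h
    rw [hhigh, Option.map_none, Option.toList_none, List.filterMap_eq_nil_iff]
    intro e he
    refine if_neg fun hc => ?_
    obtain ⟨hi, he'⟩ := (edgeColor_eq_agentColor_iff hE he).1 hc.2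
    have ho : e.1 = E[a.val / 2].2 := hc.1.trans (ownerOf_two_mul_add_one hi (by omega))
    apply fst_ne_snd_of_listsHasseEdges hE hi
    rw [← ho, he']

theorem isIso_constructInstance (hE : ListsHasseEdges E) :
    (edgeClasses label E hE).prefs.IsIso
      (constructInstance E (edgeColor E) (colorsAt label E)) := by
  refine ⟨Equiv.ofBijective _ (toAgent_bijective hE), Equiv.ofBijective _ (toAgent_bijective hE),
    fun a => ?_, fun a => ?_⟩
  · simp only [Equiv.ofBijective_apply, constructInstance, CyclicClasses.prefs,
      nextAgent_toAgent hE]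
    rw [filterMap_lower hE a]
    cases (edgeClasses label E hE).low a <;> simp
  · simp only [Equiv.ofBijective_apply, constructInstance, CyclicClasses.prefs,
      prevAgent_toAgent hE]
    rw [filterMap_upper hE a]
    cases (edgeClasses label E hE).high a <;> simp

end Concrete

/-! ## Bounded lists and the output of the program -/

theorem CyclicClasses.mem_bound_three {X : Type*} [PartialOrder X] {n : ℕ}
    (C : CyclicClasses X (Fin n)) : C.prefs ∈ Bound 3 n := by
  refine ⟨C.isSMInstance, fun m => ?_, fun w => ?_⟩
  · cases h : C.low m <;> simp [CyclicClasses.prefs, h]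
  · cases h : C.high w <;> simp [CyclicClasses.prefs, h]

theorem bound_mono {k k' n : ℕ} (h : k ≤ k') : Bound k n ⊆ Bound k' n :=
  fun _ hI => ⟨hI.1, fun m => (hI.2.1 m).trans h, fun w => (hI.2.2 w).trans h⟩

theorem flatMap_ofFn_encodeList {n : ℕ} {f : Fin n → List (Fin n)} {g : ℕ → List ℕ}
    (h : ∀ a, encodeList (f a) = g a.val) :
    (List.ofFn f).flatMap encodeList = (List.range n).flatMap g := by
  rw [List.ofFn_eq_map, ← List.map_coe_finRange_eq_range, List.flatMap_map, List.flatMap_map]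
  exact List.flatMap_congr fun a _ => h a

section Concrete

variable {X : Type u} [PartialOrder X] [DecidableEq X] {p : ℕ} {label : X ≃ Fin p}
  {E : List (X × X)}

theorem prv_val (hE : ListsHasseEdges E) (a : Fin (numAgents label E)) :
    ((edgeClasses label E hE).prv a).val =
      prevOcc (fun a => (agentOwners label E).getD a 0) (numAgents label E) a := by
  have hl : (agentsAt label E (ownerOf label E a)).map Fin.val =
      (List.range (numAgents label E)).filter fun b =>
        (agentOwners label E).getD b 0 = (agentOwners label E).getD a 0 := by
    rw [map_val_agentsAt, ← ownerOf_eq_iff.1 rfl]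
  rw [prevOcc_eq a.2 (by simp)]
  have := prev_map ((nodup_agentsAt label E (ownerOf label E a)).map Fin.val_injective)
    (mem_agentsAt.2 rfl)
  refine this.symm.trans ?_
  congr 1

theorem encodeList_men (hE : ListsHasseEdges E) {next : ℕ → ℕ}
    (hnext : ∀ a, next a.val = ((edgeClasses label E hE).nxt a).val)
    (a : Fin (numAgents label E)) :
    encodeList ((edgeClasses label E hE).prefs.men a) = manCode E.length next a := by
  rw [manCode, hnext]
  by_cases h : a.val < E.length + E.length ∧ a.val % 2 = 1
  · have hlow : (edgeClasses label E hE).low a = some _ := if_pos h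
    rw [if_pos h]
    simp [CyclicClasses.prefs, hlow, encodeList]
  · have hlow : (edgeClasses label E hE).low a = none := if_neg h
    rw [if_neg h]
    simp [CyclicClasses.prefs, hlow, encodeList]

theorem encodeList_women (hE : ListsHasseEdges E) {prev : ℕ → ℕ}
    (hprev : ∀ a, prev a.val = ((edgeClasses label E hE).prv a).val)
    (a : Fin (numAgents label E)) :
    encodeList ((edgeClasses label E hE).prefs.women a) = womanCode E.length prev a := by
  rw [womanCode, hprev]
  by_cases h : a.val < E.length + E.length ∧ a.val % 2 = 0
  · have hhigh : (edgeClasses label E hE).high a = some _ := dif_pos h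
    rw [if_pos h]
    simp [CyclicClasses.prefs, hhigh, encodeList]
  · have hhigh : (edgeClasses label E hE).high a = none := dif_neg h
    rw [if_neg h]
    simp [CyclicClasses.prefs, hhigh, encodeList]

theorem computesWithin_edgeClasses (hp : 0 < p) (hE : ListsHasseEdges E) :
    ComputesWithin prog (encodeHasse label E) (encodePrefs (edgeClasses label E hE).prefs)
      (1000 * (p + E.length + 1)) := by
  obtain ⟨next, prev, h1, h2, h3⟩ := computesWithin_prog (p := p) (q := E.length)
    (F := edgeEnds label E) hp (length_edgeEnds label E) (by
      intro a ha b hb h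
      rw [← prv_val hE ⟨a, ha⟩, ← prv_val hE ⟨b, hb⟩] at h
      -- Injectivity of the predecessor map, which keeps the writes to array `4` apart, follows from
      -- its inverse `nxt`.
      have := congrArg (edgeClasses label E hE).nxt (Fin.ext h)
      simpa using this)
  have hprev : ∀ a : Fin (numAgents label E),
      prev a.val = ((edgeClasses label E hE).prv a).val := fun a => by
    rw [h1 a.val a.2, prv_val]
  have hnext : ∀ a : Fin (numAgents label E),
      next a.val = ((edgeClasses label E hE).nxt a).val := fun a => by
    -- The program determines `next` only as a left inverse of `prev`; evaluating this at `nxt a`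
    -- identifies it with `nxt`.
    rw [← h2 _ ((edgeClasses label E hE).nxt a).2, hprev, (edgeClasses label E hE).prv_nxt]
  rw [encodePrefs, flatMap_ofFn_encodeList (encodeList_men hE hnext),
    flatMap_ofFn_encodeList (encodeList_women hE hprev)]
  exact h3

end Concrete

/-! ### The empty poset, and the conclusion -/

/-- The instance with one man and one woman. -/
def singlePair : Prefs (Fin 1) (Fin 1) where
  men _ := [0]
  women _ := [0]

theorem not_better_singleton {α : Type*} {x a b : α} : ¬ Better [x] a b := by
  simp [better_cons, better_nil]

theorem singlePair_mem_bound : singlePair ∈ Bound 3 1 := by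
  have hμ : ∀ μ, singlePair.IsStable μ → (0, 0) ∈ μ := by
    intro μ h
    by_contra hn
    refine h.2 0 0 ⟨by simp [Prefs.Acceptable, singlePair], .inl fun w => ?_, .inl fun m => ?_⟩
    · rwa [Subsingleton.elim w 0]
    · rwa [Subsingleton.elim m 0]
  refine ⟨⟨by simp [singlePair], by simp [singlePair], fun m w => ?_, fun μ h m => ?_,
    fun μ h w => ?_⟩, by simp [singlePair], by simp [singlePair]⟩
  · simp [singlePair, Subsingleton.elim m 0, Subsingleton.elim w 0]
  · exact ⟨0, Subsingleton.elim 0 m ▸ hμ μ h⟩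
  · exact ⟨0, Subsingleton.elim 0 w ▸ hμ μ h⟩

/-- A list of length one offers no next woman, so there are no rotations. -/
theorem realizes_singlePair (X : Type*) [PartialOrder X] [IsEmpty X] : singlePair.Realizes X := by
  have : IsEmpty singlePair.rotations := by
    refine ⟨fun ⟨ρ, μ, h⟩ => ?_⟩
    rcases ρ with ⟨l⟩
    obtain ⟨x, hx⟩ := List.exists_mem_of_ne_nil l fun e => h.ne_nil (by rw [e]; rfl)
    exact not_better_singleton (h.next x _ ⟨h.nodup, hx, rfl⟩).1
  exact ⟨Equiv.equivOfIsEmpty _ _, fun x => isEmptyElim x⟩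

theorem exists_bounded_instance {X : Type u} [PartialOrder X] [DecidableEq X] {p : ℕ}
    (label : X ≃ Fin p) {E : List (X × X)} (hE : ListsHasseEdges E) :
    ∃ (n : ℕ) (I : Prefs (Fin n) (Fin n)),
      0 < n ∧ I ∈ Bound 3 n ∧ I.Realizes X ∧ 2 * n ≤ 1000 * (p + E.length + 1) ∧
      RAM.ComputesWithin prog (encodeHasse label E) (encodePrefs I) (1000 * (p + E.length + 1)) ∧
      (Nonempty X → ∃ (φ : X → X → ℕ+) (π : X → List ℕ+),
        IsSuperColoring φ ∧ IsColorOrdering φ π ∧ I.IsIso (constructInstance E φ π)) := by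
  rcases Nat.eq_zero_or_pos p with rfl | hp
  · have : IsEmpty X := label.isEmpty
    obtain rfl : E = [] := List.eq_nil_iff_forall_not_mem.2 fun e => isEmptyElim e.1
    exact ⟨1, singlePair, one_pos, singlePair_mem_bound, realizes_singlePair X, by norm_num,
      computesWithin_prog_zero, fun ⟨x⟩ => isEmptyElim x⟩
  · have : Finite X := .of_equiv _ label.symm
    have hn := length_owners_le p (edgeEnds label E)
    rw [length_edgeEnds] at hn
    let v : X := label.symm ⟨0, hp⟩
    refine ⟨numAgents label E, (edgeClasses label E hE).prefs, ?_,
      (edgeClasses label E hE).mem_bound_three, (edgeClasses label E hE).realizes, ?_,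
      computesWithin_edgeClasses hp hE, fun _ => ⟨edgeColor E, colorsAt label E,
        isSuperColoring_edgeColor hE, isColorOrdering_colorsAt hE, isIso_constructInstance hE⟩⟩
    · obtain ⟨a, -⟩ := List.exists_mem_of_length_pos
        (lt_of_lt_of_le two_pos ((edgeClasses label E hE).two_le v))
      exact a.pos
    · change 2 * (owners p (edgeEnds label E)).length ≤ _
      omega

theorem exists_listsHasseEdges (X : Type*) [PartialOrder X] [Finite X] :
    ∃ E : List (X × X), ListsHasseEdges E := by
  classical
  have := Fintype.ofFinite X
  refine ⟨(Finset.univ.filter fun e : X × X => e.1 ⋖ e.2).toList, Finset.nodup_toList _, ?_⟩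
  simp

end StableMarriage

theorem mainTheorem3 :
    (∃ (P : RAM.Prog) (C : ℕ),
      ∀ (X : Type u) [PartialOrder X] [DecidableEq X] (p : ℕ) (label : X ≃ Fin p)
        (E : List (X × X)), ListsHasseEdges E →
        ∃ (n : ℕ) (I : Prefs (Fin n) (Fin n)),
          0 < n ∧ I ∈ Bound 3 n ∧ I.Realizes X ∧
          2 * n ≤ C * (p + E.length + 1) ∧
          RAM.ComputesWithin P (encodeHasse label E) (encodePrefs I)
            (C * (p + E.length + 1)) ∧
          (Nonempty X → ∃ (φ : X → X → ℕ+) (π : X → List ℕ+),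
            IsSuperColoring φ ∧ IsColorOrdering φ π ∧
            I.IsIso (constructInstance E φ π)) ∧
          ∀ k : ℕ, 3 ≤ k → I ∈ Bound k n) ∧
    ∀ (k : ℕ), 3 ≤ k → ∀ (X : Type u) [PartialOrder X] [Finite X],
      ∃ (n : ℕ) (I : Prefs (Fin n) (Fin n)), 0 < n ∧ I ∈ Bound k n ∧ I.Realizes X := by
  refine ⟨⟨RAM.prog, 1000, fun X _ _ p label E hE => ?_⟩, fun k hk X _ _ => ?_⟩
  · obtain ⟨n, I, h1, h2, h3, h4, h5, h6⟩ := exists_bounded_instance label hE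
    exact ⟨n, I, h1, h2, h3, h4, h5, h6, fun k hk => bound_mono hk h2⟩
  · classical
    obtain ⟨E, hE⟩ := exists_listsHasseEdges X
    obtain ⟨n, I, h1, h2, h3, -⟩ := exists_bounded_instance (Finite.equivFin X) hE
    exact ⟨n, I, h1, bound_mono hk h2, h3⟩
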